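/- Let $\Gamma$ be a countable group. A pmp action $\mathbf a=\Gamma\curvearrowright^a(X,\mu)$ is a measurable action of $\Gamma$ on a standard Borel space $X$ preserving a Borel probability measure $\mu$. For pmp actions $\mathbf a=\Gamma\curvearrowright^a(X,\mu)$ and $\mathbf b=\Gamma\curvearrowright^b(Y,\nu)$, we say that $\mathbf a$ is *weakly contained* in $\mathbf b$, written $\mathbf a\prec\mathbf b$, if for every finite measurable partition $\{P_i\}_{i=1}^n$ of $X$, every finite $S\subseteq\Gamma$ and every $\epsilon>0$ there is a measurable partition $\{Q_i\}_{i=1}^n$ of $Y$ (pieces may be empty) such that $|\mu(\gamma^aP_i\cap P_j)-\nu(\gamma^bQ_i\cap Q_j)|<\epsilon$ for all $\gamma\in S$ and $1\le i,j\le n$. The actions are *weakly equivalent*, $\mathbf a\sim\mathbf b$, if $\mathbf a\prec\mathbf b$ and $\mathbf b\prec\mathbf a$. For $s\in(0,1]$ and pmp actions $\mathbf b=\Gamma\curvearrowright^b(Y,\nu)$, $\mathbf c=\Gamma\curvearrowright^c(Y',\nu')$, the action $s\mathbf b\oplus(1-s)\mathbf c$ is the componentwise action of $\Gamma$ on the disjoint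 union $Y\sqcup Y'$ with the measure $E\mapsto s\,\nu(E\cap Y)+(1-s)\,\nu'(E\cap Y')$. An *ergodic decomposition* of $\mathbf b$ consists of a probability space $(Z,\eta)$ and a measurable family $(\nu_z)_{z\in Z}$ of Borel probability measures on $Y$ such that $\nu_z$ is $\Gamma$-invariant and ergodic for $\eta$-almost every $z$ and $\nu=\int_Z\nu_z\,d\eta(z)$; the actions $\Gamma\curvearrowright^b(Y,\nu_z)$ are the *ergodic components* of $\mathbf b$. A property holds for almost every ergodic component of $\mathbf b$ if, for every ergodic decomposition of $\mathbf b$, it holds for $\Gamma\curvearrowright^b(Y,\nu_z)$ for $\eta$-almost every $z$. **Theorem.** Let $\mathbf a=\Gamma\curvearrowright^a(X,\mu)$, $\mathbf b=\Gamma\curvearrowright^b(Y,\nu)$ and $\mathbf c=\Gamma\curvearrowright^c(Y',\nu')$ be pmp actions of $\Gamma$, and assume that $\mathbf a$ is ergodic. 1. If $\mathbf a\prec s\mathbf b\oplus(1-s)\mathbf c$ for some $0<s\le1$, then $\mathbf a\prec\mathbf b$; moreover, $\mathbf a$ is weakly contained in almost every ergodic component of $\mathbf b$. 2. If $s\mathbf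 b\oplus(1-s)\mathbf c\prec\mathbf a$ for some $0<s\le1$, then $\mathbf b\prec\mathbf a$; moreover, almost every ergodic component of $\mathbf b$ is weakly contained in $\mathbf a$. 3. If $s\mathbf b\oplus(1-s)\mathbf c\sim\mathbf a$ for some $0<s\le1$, then $\mathbf b\sim\mathbf a$; moreover, almost every ergodic component of $\mathbf b$ is weakly equivalent to $\mathbf a$. -/

import Mathlib

open MeasureTheory ProbabilityTheory
open scoped Pointwise

universe u v w x z

/-- `P` is a measurable partition of `X` indexed by `ι` (pieces are allowed to be empty). -/
def IsMeasurablePartition {ι : Type*} {X : Type*} [MeasurableSpace X] (P : ι → Set X) : Prop :=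
  (∀ i, MeasurableSet (P i)) ∧ Pairwise (fun i j => Disjoint (P i) (P j)) ∧ ⋃ i, P i = Set.univ

/-- Weak containment `Γ ↷ (X, μ) ≺ Γ ↷ (Y, ν)`: for every finite measurable partition `P` of `X`,
every finite `S ⊆ Γ` and every `ε > 0` there is a measurable partition `Q` of `Y` with
`|μ(γ P i ∩ P j) - ν(γ Q i ∩ Q j)| < ε` for all `γ ∈ S` and all `i, j`. -/
def WeaklyContained (Γ : Type*) {X Y : Type*} [Group Γ]
    [MeasurableSpace X] [MulAction Γ X] [MeasurableSpace Y] [MulAction Γ Y]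
    (μ : Measure X) (ν : Measure Y) : Prop :=
  ∀ (n : ℕ) (P : Fin n → Set X), IsMeasurablePartition P →
    ∀ (S : Finset Γ) (ε : ℝ), 0 < ε →
      ∃ Q : Fin n → Set Y, IsMeasurablePartition Q ∧
        ∀ γ ∈ S, ∀ i j : Fin n,
          |μ.real ((γ • P i) ∩ P j) - ν.real ((γ • Q i) ∩ Q j)| < ε

/-- Weak equivalence: weak containment in both directions. -/
def WeaklyEquivalent (Γ : Type*) {X Y : Type*} [Group Γ]
    [MeasurableSpace X] [MulAction Γ X] [MeasurableSpace Y] [MulAction Γ Y]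
    (μ : Measure X) (ν : Measure Y) : Prop :=
  WeaklyContained Γ μ ν ∧ WeaklyContained Γ ν μ

/-- The measure `μ ⊕ ν` on the disjoint union `X ⊔ Y`,
`(μ ⊕ ν)(E) = μ(E ∩ X) + ν(E ∩ Y)`. The group acts on `X ⊕ Y` componentwise, by Mathlib's
action on a sum type. -/
noncomputable def directSumMeasure {X Y : Type*} [MeasurableSpace X] [MeasurableSpace Y]
    (μ : Measure X) (ν : Measure Y) : Measure (X ⊕ Y) :=
  μ.map Sum.inl + ν.map Sum.inr

/-- The measure of the action `s b ⊕ (1 - s) c`, where `b` carries `μ` and `c` carries `ν`. -/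
noncomputable def convexSumMeasure {X Y : Type*} [MeasurableSpace X] [MeasurableSpace Y]
    (s : ℝ) (μ : Measure X) (ν : Measure Y) : Measure (X ⊕ Y) :=
  directSumMeasure (ENNReal.ofReal s • μ) (ENNReal.ofReal (1 - s) • ν)

/-- `ν = ∫ κ z dη(z)` is an ergodic decomposition of `Γ ↷ (Y, ν)`: a measurable family of
probability measures on `Y`, almost all of them invariant and ergodic, with barycentre `ν`. The
actions `Γ ↷ (Y, κ z)` are the ergodic components. -/
structure IsErgodicDecomposition (Γ : Type*) {Y : Type*} [Group Γ] [MeasurableSpace Y]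
    [MulAction Γ Y] (ν : Measure Y) {Z : Type*} [MeasurableSpace Z] (η : Measure Z)
    (κ : Kernel Z Y) : Prop where
  isProbabilityMeasure_base : IsProbabilityMeasure η
  isMarkovKernel : IsMarkovKernel κ
  ergodic : ∀ᵐ z ∂η, ErgodicSMul Γ Y (κ z)
  bind_eq : η.bind κ = ν

/-- Almost every ergodic component of `Γ ↷ (Y, ν)` has the property `p`. (The ergodic
decomposition is unique up to its parametrisation; the property is asked for every
parametrisation by a probability space.) -/
def AlmostEveryErgodicComponent (Γ : Type u) {Y : Type v} [Group Γ] [MeasurableSpace Y]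
    [MulAction Γ Y] (ν : Measure Y) (p : Measure Y → Prop) : Prop :=
  ∀ (Z : Type z) [MeasurableSpace Z] (η : Measure Z) (κ : Kernel Z Y),
    IsErgodicDecomposition Γ ν η κ → ∀ᵐ t ∂η, p (κ t)

/-!
Finite measurable partitions are encoded as labellings `l : X → ι` with `ι` finite; the statistics
that define weak containment are then the numbers
`pairStat μ l g i j = μ {x | l (g x) = i, l x = j}`. Write `μ ≺ ν` for weak containment.

The common tool is a mean ergodic theorem valid for every group (`exists_invariant_average`): for
`f : Y → [0, 1]` and an invariant probability measure `ν`, suitable convex combinations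
`∑ c g * f (g • y)` converge in `L¹(ν)` to an invariant function `h`, namely the vector of minimal
norm in the closed convex hull of the orbit of `f` in `L²(ν)`. For ergodic `ν` the limit is the
constant `∫ f ∂ν`.

*Ergodic `μ ≺ ν`.* Averages of the indicator of `{l (g x) = i, l x = j}` are close in mean to the
constant `pairStat μ l g i j`. This is a property of the joint distribution of finitely many labels
along an orbit, and weak containment approximates such distributions
(`WeaklyContained.exists_itinerary`). So there is a labelling `q` of `Y` for which the averages of
the corresponding indicators deviate from `pairStat μ l g i j` by a function `G` with small
`ν`-integral. For each invariant probability measure `ρ`, the difference of the statistics of `l`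
and `q` is at most `∫ G ∂ρ` (`WeaklyContained.exists_uniform_label`). Take for `ρ` a summand of `ν`,
or the components of `ν` and apply Markov's inequality.

*`ν ≺ μ` with `μ` ergodic.* Let `A` be an invariant set with `ν A = s > 0`. A labelling of `A` gives
labellings of almost invariant subsets of `X` of measure about `s` with the right statistics, scaled
by `s`. By ergodicity, a sufficiently invariant set is almost independent of all events fixed before
(`exists_finset_abs_measureReal_inter_sub_le`). Hence placing such partial labellings successively
on top of each other, one gets partial labellings with the right statistics on sets of measure about
`1 - (1 - s) ^ m`, and in the limit the normalized restriction of `ν` to `A` is weakly contained in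
`μ` (`WeaklyContained.of_invariant_set`). With `A = Y` inside `Y ⊕ Y'` this treats the summand of a
convex sum. For ergodic components, let `F` be the vector of the limits `h` of the averages of the
indicators that belong to a labelling `l` of `Y`. On almost every component `F` is constant, equal
to the statistics of `l` there, and this value lies in the support of the distribution of `F` under
`ν`. So the statistics of the component are almost those of the restriction of `ν` to the invariant
set where `F` is close to that value.

In both directions the tests range over all labellings, but countably many of them suffice
(`ae_weaklyContained_of_forall_label`), so they can be interchanged with "almost every component".
-/

/-! ### A mean ergodic theorem for arbitrary groups -/

/-- Linear isometries that map `O` to itself have a common fixed vector in the closed convex hull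
of `O`, namely its vector of minimal norm. -/
theorem exists_mem_closure_convexHull_forall_map_eq {I E : Type*} [NormedAddCommGroup E]
    [InnerProductSpace ℝ E] [CompleteSpace E] {O : Set E} (hO : O.Nonempty) (U : I → E →ₗᵢ[ℝ] E)
    (hU : ∀ i, Set.MapsTo (U i) O O) :
    ∃ v ∈ closure (convexHull ℝ O), ∀ i, U i v = v := by
  have hconv : Convex ℝ (closure (convexHull ℝ O)) := (convex_convexHull ℝ O).closure
  obtain ⟨v, hv, hmin⟩ := exists_norm_eq_iInf_of_complete_convex
    (hO.convexHull (𝕜 := ℝ)).closure isClosed_closure.isComplete hconv 0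
  refine ⟨v, hv, fun i => ?_⟩
  rw [norm_eq_iInf_iff_real_inner_le_zero hconv hv] at hmin
  have hmaps : Set.MapsTo (U i) (convexHull ℝ O) (convexHull ℝ O) := by
    refine Set.mapsTo_iff_image_subset.2 ?_
    have := (U i).toLinearMap.image_convexHull O
    change (U i).toLinearMap '' _ ⊆ _
    rw [this]
    exact convexHull_mono (Set.mapsTo_iff_image_subset.1 (hU i))
  have h1 := hmin (U i v) (hmaps.closure (U i).continuous hv)
  rw [← sub_eq_zero, ← norm_le_zero_iff]
  have h2 : ‖U i v - v‖ ^ 2 ≤ 0 := by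
    rw [@norm_sub_sq_real, (U i).norm_map]
    rw [inner_sub_right, zero_sub, inner_neg_left, inner_neg_left, real_inner_self_eq_norm_sq,
      real_inner_comm] at h1
    linarith
  exact (pow_eq_zero_iff two_ne_zero).1 (le_antisymm h2 (sq_nonneg _)) |>.le

/-- Clamping to `[0, 1]` does not increase the distance to a point of `[0, 1]`. -/
theorem abs_sub_clamp_le {a b : ℝ} (ha : a ∈ Set.Icc (0 : ℝ) 1) :
    |a - max 0 (min 1 b)| ≤ |a - b| := by
  obtain ⟨h0, h1⟩ := ha
  rcases le_total 1 b with h | h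
  · rw [min_eq_left h, max_eq_right zero_le_one, abs_of_nonpos (by linarith),
      abs_of_nonpos (by linarith)]
    linarith
  · rw [min_eq_right h]
    rcases le_total 0 b with h' | h'
    · rw [max_eq_right h']
    · rw [max_eq_left h', abs_of_nonneg (by linarith), abs_of_nonneg (by linarith)]
      linarith

theorem sum_mul_mem_Icc {I : Type*} {T : Finset I} {c a : I → ℝ} (hc : ∀ g ∈ T, 0 ≤ c g)
    (hc1 : ∑ g ∈ T, c g = 1) (ha : ∀ g, a g ∈ Set.Icc (0 : ℝ) 1) :
    ∑ g ∈ T, c g * a g ∈ Set.Icc (0 : ℝ) 1 := by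
  refine ⟨Finset.sum_nonneg fun g hg => mul_nonneg (hc g hg) (ha g).1, ?_⟩
  rw [← hc1]
  exact Finset.sum_le_sum fun g hg => mul_le_of_le_one_right (hc g hg) (ha g).2

theorem integrable_of_mem_Icc {Y : Type*} [MeasurableSpace Y] {ρ : Measure Y} [IsFiniteMeasure ρ]
    {f : Y → ℝ} (hf : Measurable f) {a b : ℝ} (h : ∀ y, f y ∈ Set.Icc a b) : Integrable f ρ :=
  Integrable.of_mem_Icc a b hf.aemeasurable (Filter.Eventually.of_forall h)

/-- Real-valued functions invariant under an ergodic action are almost everywhere constant. -/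
theorem exists_ae_eq_const_of_ergodicSMul {Γ Y : Type*} [Group Γ] [MeasurableSpace Y]
    [MulAction Γ Y] (ρ : Measure Y) [ErgodicSMul Γ Y ρ] {h : Y → ℝ}
    (hh : Measurable h)
    (hinv : ∀ g : Γ, (fun y => h (g • y)) =ᵐ[ρ] h) : ∃ a : ℝ, h =ᵐ[ρ] fun _ => a := by
  refine Filter.exists_eventuallyEq_const_of_forall_separating MeasurableSet fun V hV => ?_
  have := aeconst_of_forall_preimage_smul_ae_eq Γ (hh hV).nullMeasurableSet (μ := ρ) fun g => by
    filter_upwards [hinv g] with y hy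
    exact congrArg V hy
  exact Filter.eventuallyConst_set.1 this

section MeanErgodic

variable {Γ : Type*} [Group Γ] {Y : Type*} [MeasurableSpace Y] [MulAction Γ Y]
  [MeasurableConstSMul Γ Y]

theorem measurable_average {f : Y → ℝ} (hf : Measurable f) (T : Finset Γ) (c : Γ → ℝ) :
    Measurable fun y => ∑ g ∈ T, c g * f (g • y) :=
  Finset.measurable_fun_sum _ fun g _ => (hf.comp (measurable_const_smul g)).const_mul _

/-- Convex combinations of translates of `f` converge in `L¹` to an invariant function. -/
theorem exists_invariant_average (ν : Measure Y) [IsProbabilityMeasure ν]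
    [SMulInvariantMeasure Γ Y ν] {f : Y → ℝ} (hf : Measurable f)
    (hf01 : ∀ y, f y ∈ Set.Icc (0 : ℝ) 1) :
    ∃ h : Y → ℝ, Measurable h ∧ (∀ y, h y ∈ Set.Icc (0 : ℝ) 1) ∧
      (∀ g : Γ, (fun y => h (g • y)) =ᵐ[ν] h) ∧
      ∀ ε : ℝ, 0 < ε → ∃ (T : Finset Γ) (c : Γ → ℝ), (∀ g ∈ T, 0 ≤ c g) ∧ ∑ g ∈ T, c g = 1 ∧
        ∫ y, |∑ g ∈ T, c g * f (g • y) - h y| ∂ν < ε := by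
  have hfL : MemLp f 2 ν := by
    refine MemLp.of_bound hf.aestronglyMeasurable 1 (Filter.Eventually.of_forall fun y => ?_)
    rw [Real.norm_eq_abs, abs_of_nonneg (hf01 y).1]
    exact (hf01 y).2
  let U : Γ → Lp ℝ 2 ν →ₗᵢ[ℝ] Lp ℝ 2 ν := fun g =>
    Lp.compMeasurePreservingₗᵢ ℝ (g • ·) (measurePreserving_smul g ν)
  have hU (g : Γ) (u : Lp ℝ 2 ν) : U g u =ᵐ[ν] fun y => u (g • y) :=
    Lp.coeFn_compMeasurePreserving u (measurePreserving_smul g ν)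
  let F : Γ → Lp ℝ 2 ν := fun g => U g (hfL.toLp f)
  have hF (g : Γ) : F g =ᵐ[ν] fun y => f (g • y) :=
    (hU g _).trans
      ((measurePreserving_smul g ν).quasiMeasurePreserving.ae_eq_comp hfL.coeFn_toLp)
  obtain ⟨v, hv, hvU⟩ := exists_mem_closure_convexHull_forall_map_eq (O := Set.range F)
    (Set.range_nonempty F) U (by
      rintro g _ ⟨g', rfl⟩
      refine ⟨g' * g, ?_⟩
      refine Lp.ext ?_
      filter_upwards [hF (g' * g), hU g (F g'),
        (measurePreserving_smul g ν).quasiMeasurePreserving.ae_eq_comp (hF g')] with y h1 h2 h3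
      simp only [Function.comp_apply] at h3
      rw [h1, h2, h3, mul_smul])
  have hvm : AEStronglyMeasurable v ν := Lp.aestronglyMeasurable v
  obtain ⟨h', hh'm, hh'v⟩ := hvm.aemeasurable
  refine ⟨fun y => max 0 (min 1 (h' y)), by fun_prop, fun y => ⟨le_max_left _ _,
    max_le zero_le_one (min_le_left _ _)⟩, fun g => ?_, fun ε hε => ?_⟩
  · have h1 : (fun y => h' (g • y)) =ᵐ[ν] h' := by
      have h2 := (measurePreserving_smul g ν).quasiMeasurePreserving.ae_eq_comp hh'v
      have h3 := hU g v
      rw [hvU g] at h3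
      exact (h2.symm.trans h3.symm).trans hh'v
    filter_upwards [h1] with y hy
    rw [hy]
  · obtain ⟨w, hw, hwv⟩ := Metric.mem_closure_iff.1 hv ε hε
    rw [convexHull_range_eq_exists_affineCombination] at hw
    obtain ⟨T, c, hc, hc1, rfl⟩ := hw
    refine ⟨T, c, hc, hc1, ?_⟩
    rw [Finset.affineCombination_eq_linear_combination _ _ _ hc1] at hwv
    set w : Lp ℝ 2 ν := ∑ g ∈ T, c g • F g with hwdef
    have hwf : w =ᵐ[ν] fun y => ∑ g ∈ T, c g * f (g • y) := by
      have h1 : (w : Y → ℝ) =ᵐ[ν] fun y => ∑ g ∈ T, (c g • F g : Lp ℝ 2 ν) y := by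
        rw [hwdef]
        exact Lp.coeFn_fun_finsetSum _ _
      refine h1.trans ?_
      have h2 : ∀ g, (c g • F g : Lp ℝ 2 ν) =ᵐ[ν] fun y => c g * f (g • y) := fun g => by
        filter_upwards [Lp.coeFn_smul (c g) (F g), hF g] with y h3 h4
        rw [h3, Pi.smul_apply, h4, smul_eq_mul]
      have h3 : ∀ᵐ y ∂ν, ∀ g ∈ T, (c g • F g : Lp ℝ 2 ν) y = c g * f (g • y) :=
        (Filter.eventually_all_finset T).2 fun g _ => h2 g
      filter_upwards [h3] with y hy
      exact Finset.sum_congr rfl hy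
    have hm := measurable_average hf T c
    have hb : ∀ y, ∑ g ∈ T, c g * f (g • y) ∈ Set.Icc (0 : ℝ) 1 := fun y =>
      sum_mul_mem_Icc hc hc1 fun g => hf01 (g • y)
    have hint : Integrable (fun y => |(v - w : Lp ℝ 2 ν) y|) ν :=
      ((Lp.memLp (v - w)).integrable one_le_two).abs
    calc ∫ y, |∑ g ∈ T, c g * f (g • y) - max 0 (min 1 (h' y))| ∂ν
        ≤ ∫ y, |(v - w : Lp ℝ 2 ν) y| ∂ν := by
          refine integral_mono_of_nonneg (Filter.Eventually.of_forall fun y => abs_nonneg _) hint ?_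
          filter_upwards [hwf, hh'v, Lp.coeFn_sub v w] with y h1 h2 h3
          rw [h3, Pi.sub_apply, h1, h2, abs_sub_comm (h' y)]
          exact abs_sub_clamp_le (hb y)
      _ ≤ ‖v - w‖ := by
          have h1 := eLpNorm_le_eLpNorm_of_exponent_le (p := 1) (q := 2) one_le_two
            (Lp.aestronglyMeasurable (v - w))
          rw [Lp.norm_def]
          refine le_trans (le_of_eq ?_) (ENNReal.toReal_mono (Lp.eLpNorm_ne_top _) h1)
          rw [eLpNorm_one_eq_lintegral_enorm, ← integral_norm_eq_lintegral_enorm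
            (Lp.aestronglyMeasurable _)]
          rfl
      _ < ε := by rwa [← dist_eq_norm]

/-- An invariant function approximated by averages of `f` has the same integral as `f`, up to the
quality of the approximation, for every invariant measure. -/
theorem abs_integral_sub_integral_le_average (ρ : Measure Y) [IsFiniteMeasure ρ]
    [SMulInvariantMeasure Γ Y ρ] {f h : Y → ℝ} (hf : Measurable f)
    (hf01 : ∀ y, f y ∈ Set.Icc (0 : ℝ) 1) (hh : Measurable h)
    (hh01 : ∀ y, h y ∈ Set.Icc (0 : ℝ) 1) {T : Finset Γ} {c : Γ → ℝ} (hc1 : ∑ g ∈ T, c g = 1) :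
    |∫ y, f y ∂ρ - ∫ y, h y ∂ρ| ≤ ∫ y, |∑ g ∈ T, c g * f (g • y) - h y| ∂ρ := by
  have hi : ∀ g : Γ, Integrable (fun y => c g * f (g • y)) ρ := fun g =>
    (integrable_of_mem_Icc (hf.comp (measurable_const_smul g)) fun y => hf01 (g • y)).const_mul _
  have h1 : ∫ y, f y ∂ρ = ∫ y, ∑ g ∈ T, c g * f (g • y) ∂ρ := by
    rw [integral_finsetSum _ fun g _ => hi g]
    have h2 : ∀ g : Γ, ∫ y, c g * f (g • y) ∂ρ = c g * ∫ y, f y ∂ρ := fun g => by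
      rw [integral_const_mul, integral_smul_eq_self]
    simp_rw [h2, ← Finset.sum_mul, hc1, one_mul]
  rw [h1, ← integral_sub (integrable_finsetSum _ fun g _ => hi g) (integrable_of_mem_Icc hh hh01)]
  exact abs_integral_le_integral_abs

/-- The averages of a function under an ergodic action converge to its integral in `L¹`. -/
theorem exists_average_sub_integral_lt (μ : Measure Y) [IsProbabilityMeasure μ] [ErgodicSMul Γ Y μ]
    {f : Y → ℝ} (hf : Measurable f) (hf01 : ∀ y, f y ∈ Set.Icc (0 : ℝ) 1) {ε : ℝ} (hε : 0 < ε) :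
    ∃ (T : Finset Γ) (c : Γ → ℝ), (∀ g ∈ T, 0 ≤ c g) ∧ ∑ g ∈ T, c g = 1 ∧
      ∫ y, |∑ g ∈ T, c g * f (g • y) - ∫ x, f x ∂μ| ∂μ < ε := by
  obtain ⟨h, hh, hh01, hinv, happ⟩ := exists_invariant_average (Γ := Γ) μ hf hf01
  obtain ⟨a, ha⟩ := exists_ae_eq_const_of_ergodicSMul (Γ := Γ) μ hh hinv
  have hfh : ∫ x, f x ∂μ = ∫ x, h x ∂μ := by
    rw [← sub_eq_zero, ← abs_nonpos_iff]
    refine le_of_forall_pos_le_add fun δ hδ => ?_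
    obtain ⟨T, c, -, hc1, hlt⟩ := happ δ hδ
    have := abs_integral_sub_integral_le_average μ hf hf01 hh hh01 hc1
    linarith
  have hfa : ∫ x, f x ∂μ = a := by
    rw [hfh, integral_congr_ae ha, integral_const, probReal_univ, one_smul]
  obtain ⟨T, c, hc, hc1, hlt⟩ := happ ε hε
  refine ⟨T, c, hc, hc1, lt_of_eq_of_lt (integral_congr_ae ?_) hlt⟩
  filter_upwards [ha] with y hy
  rw [hy, hfa]

end MeanErgodic

/-! ### Weak containment in terms of labellings -/

theorem isMeasurablePartition_fiber {ι X : Type*} [MeasurableSpace ι] [MeasurableSingletonClass ι]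
    [MeasurableSpace X] {l : X → ι} (hl : Measurable l) :
    IsMeasurablePartition fun i => l ⁻¹' {i} :=
  ⟨fun i => hl (measurableSet_singleton i), fun _ _ hij =>
    Disjoint.preimage _ (Set.disjoint_singleton.2 hij), Set.iUnion_eq_univ_iff.2 fun x => ⟨l x, rfl⟩⟩

theorem IsMeasurablePartition.exists_eq_fiber {ι X : Type*} [Countable ι] [MeasurableSpace ι]
    [MeasurableSingletonClass ι] [MeasurableSpace X] {P : ι → Set X}
    (hP : IsMeasurablePartition P) : ∃ l : X → ι, Measurable l ∧ P = fun i => l ⁻¹' {i} := by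
  choose l hl using Set.iUnion_eq_univ_iff.1 hP.2.2
  have hfib : P = fun i => l ⁻¹' {i} := by
    funext i
    ext x
    refine ⟨fun hx => ?_, fun hx => hx ▸ hl x⟩
    by_contra hne
    exact Set.disjoint_left.1 (hP.2.1 hne) (hl x) hx
  refine ⟨l, measurable_to_countable' fun i => ?_, hfib⟩
  have := hP.1 i
  rwa [hfib] at this

section Labellings

variable {Γ : Type*} [Group Γ] {X Y ι : Type*}
  [MeasurableSpace X] [MulAction Γ X] [MeasurableSpace Y] [MulAction Γ Y]

/-- The statistics of a labelling `l`: the measure of the set of points `y` with label `j` for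
which `g • y` has label `i`. -/
noncomputable def pairStat (ρ : Measure Y) (l : Y → ι) (g : Γ) (i j : ι) : ℝ :=
  ρ.real {y | l (g • y) = i ∧ l y = j}

theorem measureReal_smul_fiber_inter_fiber (ρ : Measure Y) (l : Y → ι) (g : Γ) (i j : ι) :
    ρ.real ((g • l ⁻¹' {i}) ∩ l ⁻¹' {j}) = pairStat ρ l g⁻¹ i j := by
  congr 1
  ext y
  simp [Set.mem_smul_set_iff_inv_smul_mem]

theorem weaklyContained_iff_forall_label {μ : Measure X} {ν : Measure Y} :
    WeaklyContained Γ μ ν ↔ ∀ (n : ℕ) (l : X → Fin n), Measurable l →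
      ∀ (S : Finset Γ) (ε : ℝ), 0 < ε → ∃ q : Y → Fin n, Measurable q ∧
        ∀ g ∈ S, ∀ i j, |pairStat μ l g i j - pairStat ν q g i j| < ε := by
  classical
  constructor
  · intro h n l hl S ε hε
    obtain ⟨Q, hQ, hQS⟩ := h n _ (isMeasurablePartition_fiber hl) (S.image (·⁻¹)) ε hε
    obtain ⟨q, hq, rfl⟩ := hQ.exists_eq_fiber
    refine ⟨q, hq, fun g hg i j => ?_⟩
    have := hQS g⁻¹ (Finset.mem_image_of_mem _ hg) i j
    simpa only [measureReal_smul_fiber_inter_fiber, inv_inv] using this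
  · intro h n P hP S ε hε
    obtain ⟨l, hl, rfl⟩ := hP.exists_eq_fiber
    obtain ⟨q, hq, hqS⟩ := h n l hl (S.image (·⁻¹)) ε hε
    refine ⟨_, isMeasurablePartition_fiber hq, fun g hg i j => ?_⟩
    simp only [measureReal_smul_fiber_inter_fiber]
    exact hqS g⁻¹ (Finset.mem_image_of_mem _ hg) i j

variable [Fintype ι] [MeasurableSpace ι] [MeasurableSingletonClass ι]

theorem WeaklyContained.exists_label {μ : Measure X} {ν : Measure Y}
    (h : WeaklyContained Γ μ ν) {l : X → ι} (hl : Measurable l) (S : Finset Γ) {ε : ℝ}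
    (hε : 0 < ε) : ∃ q : Y → ι, Measurable q ∧
      ∀ g ∈ S, ∀ i j, |pairStat μ l g i j - pairStat ν q g i j| < ε := by
  let e := Fintype.equivFin ι
  obtain ⟨q, hq, hqS⟩ := weaklyContained_iff_forall_label.1 h _ (e ∘ l)
    ((measurable_of_countable e).comp hl) S ε hε
  refine ⟨e.symm ∘ q, (measurable_of_countable e.symm).comp hq, fun g hg i j => ?_⟩
  have := hqS g hg (e i) (e j)
  simpa [pairStat, Equiv.symm_apply_eq] using this

variable [MeasurableConstSMul Γ X] [MeasurableConstSMul Γ Y]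

omit [Fintype ι] [MeasurableSingletonClass ι] in
theorem Measurable.comp_smul {l : Y → ι} (hl : Measurable l) (g : Γ) :
    Measurable fun y => l (g • y) :=
  hl.comp (measurable_const_smul g)

open Classical in
theorem measureReal_rel_eq_sum (ρ : Measure Y) [IsFiniteMeasure ρ] {l : Y → ι} (hl : Measurable l)
    (g : Γ) (R : ι → ι → Prop) :
    ρ.real {y | R (l (g • y)) (l y)} =
      ∑ p : ι × ι with R p.1 p.2, pairStat ρ l g p.1 p.2 := by
  have hm : Measurable fun y => (l (g • y), l y) := (hl.comp_smul g).prodMk hl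
  have := sum_measureReal_preimage_singleton (μ := ρ)
    (Finset.univ.filter fun p : ι × ι => R p.1 p.2) fun p _ => hm (measurableSet_singleton p)
  rw [Finset.coe_filter] at this
  simp only [Finset.mem_univ, true_and] at this
  change _ = ρ.real {y | R (l (g • y)) (l y)} at this
  rw [← this]
  refine Finset.sum_congr rfl fun p _ => ?_
  unfold pairStat
  congr 1
  ext y
  simp [Prod.ext_iff]

/-- Approximation of the statistics of labels controls all events defined by two labels. -/
theorem abs_measureReal_rel_sub_le {μ : Measure X} {ν : Measure Y} [IsFiniteMeasure μ]
    [IsFiniteMeasure ν] {l : X → ι} (hl : Measurable l) {q : Y → ι} (hq : Measurable q) {g : Γ}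
    {ε : ℝ} (h : ∀ i j, |pairStat μ l g i j - pairStat ν q g i j| < ε) (R : ι → ι → Prop) :
    |μ.real {x | R (l (g • x)) (l x)} - ν.real {y | R (q (g • y)) (q y)}| ≤
      Fintype.card (ι × ι) * ε := by
  classical
  rw [measureReal_rel_eq_sum μ hl, measureReal_rel_eq_sum ν hq, ← Finset.sum_sub_distrib]
  refine (Finset.abs_sum_le_sum_abs _ _).trans ?_
  refine (Finset.sum_le_univ_sum_of_nonneg fun _ => abs_nonneg _).trans ?_
  refine (Finset.sum_le_sum fun p _ => (h p.1 p.2).le).trans ?_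
  rw [Finset.sum_const, Finset.card_univ, nsmul_eq_mul]

/-- The labels seen along the finite piece `T` of an orbit. -/
def itinerary (T : Finset Γ) (l : Y → ι) (y : Y) (t : T) : ι := l ((t : Γ) • y)

omit [Fintype ι] [MeasurableSingletonClass ι] in
theorem measurable_itinerary (T : Finset Γ) {l : Y → ι} (hl : Measurable l) :
    Measurable (itinerary T l) :=
  measurable_pi_lambda _ fun t => hl.comp_smul (t : Γ)

theorem abs_measureReal_sub_le_of_subset {ρ : Measure Y} [IsFiniteMeasure ρ] {A B C : Set Y}
    (hA : MeasurableSet A) (hB : MeasurableSet B) (h : symmDiff A B ⊆ C) :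
    |ρ.real A - ρ.real B| ≤ ρ.real C :=
  (abs_measureReal_sub_le_measureReal_symmDiff hA.nullMeasurableSet hB.nullMeasurableSet).trans
    (measureReal_mono h)

/-- Weak containment approximates the distribution of labels along any finite piece of an orbit.
To see this, the definition is applied to the refined labelling which records all these labels:
the refined labels on the other side are consistent up to a set of small measure. -/
theorem WeaklyContained.exists_itinerary {μ : Measure X} {ν : Measure Y} [IsFiniteMeasure μ]
    [IsFiniteMeasure ν] (h : WeaklyContained Γ μ ν) {l : X → ι} (hl : Measurable l)
    (T : Finset Γ) {ε : ℝ} (hε : 0 < ε) :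
    ∃ q : Y → ι, Measurable q ∧ ∀ w : T → ι,
      |μ.real {x | itinerary T l x = w} - ν.real {y | itinerary T q y = w}| < ε := by
  classical
  let T' : Finset Γ := insert 1 T
  let o : T' := ⟨1, Finset.mem_insert_self _ _⟩
  let r : T → T' := fun t => ⟨t, Finset.mem_insert_of_mem t.2⟩
  let N : ℝ := ((Fintype.card ((T' → ι) × (T' → ι)) : ℕ) : ℝ)
  have hN0 : 0 ≤ N := Nat.cast_nonneg _
  set δ : ℝ := ε / ((N + 1) * (T.card + 2)) with hδ
  have hδ0 : 0 < δ := by positivity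
  have hNδ : N * δ * (T.card + 1) < ε := by
    have h1 : (N + 1) * (T.card + 2) * δ = ε := by rw [hδ]; field_simp
    nlinarith [mul_nonneg hN0 hδ0.le, (Nat.cast_nonneg T.card : (0 : ℝ) ≤ T.card),
      mul_nonneg (Nat.cast_nonneg T.card : (0 : ℝ) ≤ T.card) hδ0.le]
  obtain ⟨Q, hQ, hQS⟩ := h.exists_label (measurable_itinerary T' hl) T' hδ0
  have hq : Measurable fun y => Q y o := (measurable_pi_apply o).comp hQ
  refine ⟨fun y => Q y o, hq, fun w => ?_⟩
  have hbad (t : T) : ν.real {y | Q ((t : Γ) • y) o ≠ Q y (r t)} ≤ N * δ := by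
    have h1 := abs_measureReal_rel_sub_le (measurable_itinerary T' hl) hQ (hQS t (r t).2)
      fun a b => a o ≠ b (r t)
    have h2 : {x : X | itinerary T' l ((t : Γ) • x) o ≠ itinerary T' l x (r t)} = ∅ := by
      simp [itinerary, o, r]
    rw [h2, measureReal_empty, zero_sub, abs_neg, abs_of_nonneg measureReal_nonneg] at h1
    exact h1
  have h1 : |μ.real {x | itinerary T l x = w} - ν.real {y | Q y ∘ r = w}| ≤ N * δ := by
    have := abs_measureReal_rel_sub_le (measurable_itinerary T' hl) hQ (hQS 1 o.2)
      fun _ b => b ∘ r = w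
    exact this
  have h2 : |ν.real {y | Q y ∘ r = w} - ν.real {y | itinerary T (fun y => Q y o) y = w}| ≤
      T.card * (N * δ) := by
    refine (abs_measureReal_sub_le_of_subset
      (C := ⋃ t : T, {y | Q ((t : Γ) • y) o ≠ Q y (r t)}) ?_ ?_ ?_).trans ?_
    · exact hQ (Set.toFinite {a : T' → ι | a ∘ r = w}).measurableSet
    · exact measurable_itinerary T hq (measurableSet_singleton w)
    · intro y hy
      by_contra hcon
      simp only [Set.mem_iUnion, Set.mem_ofPred_eq, not_exists, not_not] at hcon
      have heq : itinerary T (fun y => Q y o) y = Q y ∘ r := funext hcon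
      simp [Set.mem_symmDiff, heq] at hy
    · refine (measureReal_iUnion_fintype_le _).trans ((Finset.sum_le_sum fun t _ => hbad t).trans ?_)
      simp
  calc _ ≤ N * δ + T.card * (N * δ) := (abs_sub_le _ _ _).trans (add_le_add h1 h2)
    _ = N * δ * (T.card + 1) := by ring
    _ < ε := hNδ

end Labellings

/-! ### Weak containment of an ergodic action -/

theorem exists_comp_restrict_eq {Γ ι : Type*} [Nonempty ι] {Φ : (Γ → ι) → ℝ} {T : Finset Γ}
    (hΦ : DependsOn Φ (T : Set Γ)) : ∃ Ψ : (T → ι) → ℝ,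
      ∀ w : Γ → ι, Φ w = Ψ fun t => w t := by
  classical
  refine ⟨fun a => Φ fun g => if hg : g ∈ T then a ⟨g, hg⟩ else Classical.arbitrary ι,
    fun w => hΦ fun g hg => ?_⟩
  rw [dif_pos (Finset.mem_coe.1 hg)]

section ErgodicSide

variable {Γ : Type*} [Group Γ] {X Y ι : Type*}
  [MeasurableSpace X] [MulAction Γ X] [MeasurableSpace Y] [MulAction Γ Y]
  [MeasurableConstSMul Γ X] [MeasurableConstSMul Γ Y]
  [Fintype ι] [MeasurableSpace ι] [MeasurableSingletonClass ι]

theorem measurable_comp_orbit [Nonempty ι] {Φ : (Γ → ι) → ℝ} {T : Finset Γ}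
    (hΦ : DependsOn Φ (T : Set Γ)) {l : Y → ι} (hl : Measurable l) :
    Measurable fun y => Φ fun g => l (g • y) := by
  obtain ⟨Ψ, hΨ⟩ := exists_comp_restrict_eq hΦ
  simp_rw [hΨ]
  exact (measurable_of_countable Ψ).comp (measurable_itinerary T hl)

theorem integral_comp_itinerary (ρ : Measure Y) [IsFiniteMeasure ρ] {l : Y → ι}
    (hl : Measurable l) {T : Finset Γ} (Ψ : (T → ι) → ℝ) [Fintype (T → ι)] :
    ∫ y, Ψ (itinerary T l y) ∂ρ = ∑ w, ρ.real {y | itinerary T l y = w} * Ψ w := by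
  rw [← integral_map (μ := ρ) (measurable_itinerary T hl).aemeasurable
    (measurable_of_countable Ψ).aestronglyMeasurable, integral_fintype Integrable.of_finite]
  refine Finset.sum_congr rfl fun w _ => ?_
  rw [map_measureReal_apply (measurable_itinerary T hl) (measurableSet_singleton w), smul_eq_mul]
  rfl

/-- Weak containment approximates the integral of any function of the labels along an orbit that
depends on finitely many of them. -/
theorem WeaklyContained.exists_integral_orbit {μ : Measure X} {ν : Measure Y} [IsFiniteMeasure μ]
    [IsFiniteMeasure ν] (h : WeaklyContained Γ μ ν) [Nonempty ι] {l : X → ι} (hl : Measurable l)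
    {Φ : (Γ → ι) → ℝ} {T : Finset Γ} (hΦ : DependsOn Φ (T : Set Γ)) {ε : ℝ} (hε : 0 < ε) :
    ∃ q : Y → ι, Measurable q ∧ (Measurable fun y => Φ fun g => q (g • y)) ∧
      |∫ x, Φ (fun g => l (g • x)) ∂μ - ∫ y, Φ (fun g => q (g • y)) ∂ν| < ε := by
  classical
  obtain ⟨Ψ, hΨ⟩ := exists_comp_restrict_eq hΦ
  set K : ℝ := ∑ w, |Ψ w| with hK
  have hK0 : 0 ≤ K := Finset.sum_nonneg fun w _ => abs_nonneg _
  obtain ⟨q, hq, hqT⟩ := h.exists_itinerary hl T (div_pos hε (by linarith : 0 < K + 1))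
  refine ⟨q, hq, measurable_comp_orbit hΦ hq, ?_⟩
  · simp_rw [hΨ]
    change |∫ x, Ψ (itinerary T l x) ∂μ - ∫ y, Ψ (itinerary T q y) ∂ν| < ε
    rw [integral_comp_itinerary μ hl, integral_comp_itinerary ν hq, ← Finset.sum_sub_distrib]
    calc _ ≤ ∑ w, |μ.real {x | itinerary T l x = w} * Ψ w -
            ν.real {y | itinerary T q y = w} * Ψ w| := Finset.abs_sum_le_sum_abs _ _
      _ ≤ ∑ w, ε / (K + 1) * |Ψ w| := Finset.sum_le_sum fun w _ => by
          rw [← sub_mul, abs_mul]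
          exact mul_le_mul_of_nonneg_right (hqT w).le (abs_nonneg _)
      _ = ε * (K / (K + 1)) := by rw [← Finset.mul_sum]; ring
      _ < ε := mul_lt_of_lt_one_right hε ((div_lt_one (by linarith)).2 (by linarith))

open Classical in
/-- The indicator of the event that `g • y` has label `i` and `y` has label `j`, as a function of
the labels along the orbit of `y`. -/
noncomputable def pairIndicator (g : Γ) (i j : ι) (w : Γ → ι) : ℝ :=
  if w g = i ∧ w 1 = j then 1 else 0

omit [Fintype ι] [MeasurableSpace ι] [MeasurableSingletonClass ι] in
theorem pairIndicator_mem_Icc (g : Γ) (i j : ι) (w : Γ → ι) :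
    pairIndicator g i j w ∈ Set.Icc (0 : ℝ) 1 := by
  unfold pairIndicator
  split_ifs <;> simp

omit [Fintype ι] in
theorem measurableSet_pair {l : Y → ι} (hl : Measurable l) (g : Γ) (i j : ι) :
    MeasurableSet {y | l (g • y) = i ∧ l y = j} :=
  (hl.comp_smul g (measurableSet_singleton i)).inter (hl (measurableSet_singleton j))

omit [Fintype ι] in
theorem measurable_pairIndicator {l : Y → ι} (hl : Measurable l) (g : Γ) (i j : ι) :
    Measurable fun y => pairIndicator g i j fun k => l (k • y) := by
  classical
  unfold pairIndicator
  simp only [one_smul]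
  exact Measurable.ite (measurableSet_pair hl g i j) measurable_const measurable_const

omit [Fintype ι] in
theorem integral_pairIndicator (ρ : Measure Y) {l : Y → ι} (hl : Measurable l) (g : Γ) (i j : ι) :
    ∫ y, pairIndicator g i j (fun k => l (k • y)) ∂ρ = pairStat ρ l g i j := by
  classical
  rw [pairStat, ← integral_indicator_one (measurableSet_pair hl g i j)]
  congr 1
  ext y
  simp [pairIndicator, Set.indicator_apply]

/-- The distance from `m` of an average of translates of `pairIndicator g i j`, as a function of
the labels along an orbit. -/
noncomputable def averageDeviation (T : Finset Γ) (c : Γ → ℝ) (g : Γ) (i j : ι) (m : ℝ)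
    (w : Γ → ι) : ℝ :=
  |∑ k ∈ T, c k * pairIndicator g i j (fun k' => w (k' * k)) - m|

omit [Fintype ι] [MeasurableSpace ι] [MeasurableSingletonClass ι] [MeasurableSpace Y]
  [MeasurableConstSMul Γ Y] in
theorem averageDeviation_orbit (T : Finset Γ) (c : Γ → ℝ) (g : Γ) (i j : ι) (m : ℝ) (l : Y → ι)
    (y : Y) : averageDeviation T c g i j m (fun k => l (k • y)) =
      |∑ k ∈ T, c k * pairIndicator g i j (fun k' => l (k' • k • y)) - m| := by
  simp only [averageDeviation, mul_smul]

omit [Fintype ι] [MeasurableSpace ι] [MeasurableSingletonClass ι] in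
theorem averageDeviation_mem_Icc {T : Finset Γ} {c : Γ → ℝ} (hc : ∀ k ∈ T, 0 ≤ c k)
    (hc1 : ∑ k ∈ T, c k = 1) (g : Γ) (i j : ι) {m : ℝ} (hm : m ∈ Set.Icc (0 : ℝ) 1) (w : Γ → ι) :
    averageDeviation T c g i j m w ∈ Set.Icc (0 : ℝ) 1 := by
  refine ⟨abs_nonneg _, ?_⟩
  have h := sum_mul_mem_Icc hc hc1 fun k => pairIndicator_mem_Icc g i j fun k' => w (k' * k)
  exact abs_le.2 ⟨by linarith [h.1, hm.2], by linarith [h.2, hm.1]⟩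

omit [Fintype ι] in
theorem measurable_averageDeviation {l : Y → ι} (hl : Measurable l) (T : Finset Γ) (c : Γ → ℝ)
    (g : Γ) (i j : ι) (m : ℝ) :
    Measurable fun y => averageDeviation T c g i j m fun k => l (k • y) := by
  simp_rw [averageDeviation_orbit]
  exact ((measurable_average (measurable_pairIndicator hl g i j) T c).sub_const m).abs

/-- If an ergodic action is weakly contained in another one, then its labellings can be imitated
in such a way that one function `G` of small integral bounds the deviation of the statistics with
respect to all invariant measures at once. Indeed the averages of the relevant
indicators are almost constant on the ergodic side, hence on the other side as well. -/
theorem WeaklyContained.exists_uniform_label {μ : Measure X} [IsProbabilityMeasure μ]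
    [ErgodicSMul Γ X μ] {ν : Measure Y} [IsFiniteMeasure ν] (h : WeaklyContained Γ μ ν)
    {l : X → ι} (hl : Measurable l) (S : Finset Γ) {δ : ℝ} (hδ : 0 < δ) :
    ∃ (q : Y → ι) (G : Y → ENNReal), Measurable q ∧ Measurable G ∧
      ∫⁻ y, G y ∂ν ≤ ENNReal.ofReal δ ∧
      ∀ (ρ : Measure Y) [IsProbabilityMeasure ρ] [SMulInvariantMeasure Γ Y ρ], ∀ g ∈ S, ∀ i j,
        ENNReal.ofReal |pairStat μ l g i j - pairStat ρ q g i j| ≤ ∫⁻ y, G y ∂ρ := by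
  classical
  have : Nonempty X := μ.nonempty_of_neZero
  have : Nonempty ι := this.map l
  let J : Finset (Γ × ι × ι) := S ×ˢ Finset.univ
  set η : ℝ := δ / (2 * (J.card + 1)) with hη
  have hη0 : 0 < η := by positivity
  have havg (p : Γ × ι × ι) := exists_average_sub_integral_lt (Γ := Γ) μ
    (measurable_pairIndicator hl p.1 p.2.1 p.2.2) (fun x => pairIndicator_mem_Icc _ _ _ _) hη0
  simp_rw [integral_pairIndicator μ hl] at havg
  choose T c hc hc1 hlt using havg
  let D : Γ × ι × ι → (Γ → ι) → ℝ := fun p =>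
    averageDeviation (T p) (c p) p.1 p.2.1 p.2.2 (pairStat μ l p.1 p.2.1 p.2.2)
  have hstat01 (p : Γ × ι × ι) : pairStat μ l p.1 p.2.1 p.2.2 ∈ Set.Icc (0 : ℝ) 1 :=
    ⟨measureReal_nonneg, measureReal_le_one⟩
  have hD (p w) : D p w ∈ Set.Icc (0 : ℝ) 1 :=
    averageDeviation_mem_Icc (hc p) (hc1 p) _ _ _ (hstat01 p) w
  let Φ : (Γ → ι) → ℝ := fun w => ∑ p ∈ J, D p w
  have hΦ0 (w) : 0 ≤ Φ w := Finset.sum_nonneg fun p _ => (hD p w).1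
  let U : Finset Γ := J.biUnion fun p => T p ∪ (T p).image (p.1 * ·)
  have hΦ : DependsOn Φ (U : Set Γ) := by
    intro w w' hw
    refine Finset.sum_congr rfl fun p hp => ?_
    have hsum : ∀ g ∈ T p, w (p.1 * g) = w' (p.1 * g) ∧ w (1 * g) = w' (1 * g) := by
      refine fun g hg => ⟨hw _ ?_, hw _ ?_⟩
      · exact Finset.mem_coe.2 (Finset.mem_biUnion.2
          ⟨p, hp, Finset.mem_union_right _ (Finset.mem_image_of_mem _ hg)⟩)
      · rw [one_mul]
        exact Finset.mem_coe.2 (Finset.mem_biUnion.2 ⟨p, hp, Finset.mem_union_left _ hg⟩)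
    simp only [D, averageDeviation, pairIndicator]
    congr 2
    refine Finset.sum_congr rfl fun g hg => ?_
    simp only [(hsum g hg).1, (hsum g hg).2]
  have hΦint : ∫ x, Φ (fun g => l (g • x)) ∂μ < δ / 2 := by
    simp only [Φ]
    rw [integral_finsetSum _ fun p _ => integrable_of_mem_Icc
      (measurable_averageDeviation hl _ _ _ _ _ _) fun _ => hD p _]
    calc _ ≤ ∑ p ∈ J, η := Finset.sum_le_sum fun p _ => by
          have := hlt p
          simp_rw [← averageDeviation_orbit] at this
          exact this.le
      _ = J.card * η := by rw [Finset.sum_const, nsmul_eq_mul]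
      _ < δ / 2 := by
          have : (J.card + 1) * η = δ / 2 := by rw [hη]; field_simp
          linarith
  obtain ⟨q, hq, hqm, hqΦ⟩ := h.exists_integral_orbit hl hΦ (half_pos hδ)
  refine ⟨q, fun y => ENNReal.ofReal (Φ fun g => q (g • y)), hq, hqm.ennreal_ofReal, ?_, ?_⟩
  · have hint : Integrable (fun y => Φ fun g => q (g • y)) ν :=
      integrable_finsetSum _ fun p _ => integrable_of_mem_Icc
        (measurable_averageDeviation hq _ _ _ _ _ _) fun _ => hD p _
    rw [← ofReal_integral_eq_lintegral_ofReal hint (Filter.Eventually.of_forall fun y => hΦ0 _)]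
    refine ENNReal.ofReal_le_ofReal ?_
    have := (abs_lt.1 hqΦ).1
    linarith
  · intro ρ _ _ g hg i j
    have hint : Integrable (fun y => Φ fun g => q (g • y)) ρ :=
      integrable_finsetSum _ fun p _ => integrable_of_mem_Icc
        (measurable_averageDeviation hq _ _ _ _ _ _) fun _ => hD p _
    rw [← ofReal_integral_eq_lintegral_ofReal hint (Filter.Eventually.of_forall fun y => hΦ0 _)]
    refine ENNReal.ofReal_le_ofReal ?_
    let p : Γ × ι × ι := (g, i, j)
    have hp : p ∈ J := Finset.mem_product.2 ⟨hg, Finset.mem_univ _⟩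
    have h1 := abs_integral_sub_integral_le_average (Γ := Γ) ρ (measurable_pairIndicator hq g i j)
      (fun y => pairIndicator_mem_Icc _ _ _ _) (measurable_const (a := pairStat μ l g i j))
      (fun _ => hstat01 p) (hc1 p)
    rw [integral_pairIndicator ρ hq, integral_const, probReal_univ, one_smul, abs_sub_comm] at h1
    refine h1.trans (integral_mono ?_ hint fun y => ?_)
    · simp_rw [← averageDeviation_orbit]
      exact integrable_of_mem_Icc (measurable_averageDeviation hq _ _ _ _ _ _) fun _ => hD p _
    · dsimp only
      rw [← averageDeviation_orbit (l := q)]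
      exact Finset.single_le_sum (f := fun p => D p fun g => q (g • y)) (fun p _ => (hD p _).1) hp

end ErgodicSide

section ErgodicSide

variable {Γ : Type*} [Group Γ] {X Y : Type*}
  [MeasurableSpace X] [MulAction Γ X] [MeasurableSpace Y] [MulAction Γ Y]
  [MeasurableConstSMul Γ X] [MeasurableConstSMul Γ Y]

/-- An ergodic action weakly contained in `ν` is weakly contained in every invariant probability
measure with bounded density with respect to `ν`. -/
theorem WeaklyContained.of_le_smul {μ : Measure X} [IsProbabilityMeasure μ] [ErgodicSMul Γ X μ]
    {ν : Measure Y} [IsFiniteMeasure ν] (h : WeaklyContained Γ μ ν) {ρ : Measure Y}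
    [IsProbabilityMeasure ρ] [SMulInvariantMeasure Γ Y ρ] {C : ℝ} (hC : 0 < C)
    (hρ : ρ ≤ ENNReal.ofReal C • ν) : WeaklyContained Γ μ ρ := by
  refine weaklyContained_iff_forall_label.2 fun n l hl S ε hε => ?_
  obtain ⟨q, G, hq, -, hGν, hGρ⟩ := h.exists_uniform_label hl S (δ := ε / (2 * C)) (by positivity)
  refine ⟨q, hq, fun g hg i j => ?_⟩
  have h1 : ∫⁻ y, G y ∂ρ ≤ ENNReal.ofReal (ε / 2) := calc
    _ ≤ ∫⁻ y, G y ∂(ENNReal.ofReal C • ν) := lintegral_mono' hρ le_rfl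
    _ = ENNReal.ofReal C * ∫⁻ y, G y ∂ν := by rw [lintegral_smul_measure, smul_eq_mul]
    _ ≤ ENNReal.ofReal C * ENNReal.ofReal (ε / (2 * C)) := by gcongr
    _ = ENNReal.ofReal (ε / 2) := by
      rw [← ENNReal.ofReal_mul hC.le]
      congr 1
      field_simp
  have h2 := (ENNReal.ofReal_le_ofReal_iff (by positivity)).1 ((hGρ ρ g hg i j).trans h1)
  linarith

/-- A single test of weak containment of an ergodic action passes for almost every component. -/
theorem WeaklyContained.ae_exists_label {ι : Type*} [Fintype ι] [MeasurableSpace ι]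
    [MeasurableSingletonClass ι] {μ : Measure X} [IsProbabilityMeasure μ] [ErgodicSMul Γ X μ]
    {ν : Measure Y} [IsFiniteMeasure ν] (h : WeaklyContained Γ μ ν) {Z : Type*} [MeasurableSpace Z]
    {η : Measure Z} {κ : Kernel Z Y} (hκ : IsErgodicDecomposition Γ ν η κ) {l : X → ι}
    (hl : Measurable l) (S : Finset Γ) {ε : ℝ} (hε : 0 < ε) :
    ∀ᵐ z ∂η, ∃ q : Y → ι, Measurable q ∧
      ∀ g ∈ S, ∀ i j, |pairStat μ l g i j - pairStat (κ z) q g i j| < ε := by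
  have := hκ.isMarkovKernel
  rw [ae_iff, ← nonpos_iff_eq_zero]
  refine ENNReal.le_of_forall_pos_le_add fun δ hδ _ => ?_
  obtain ⟨q, G, hq, hG, hGν, hGρ⟩ := h.exists_uniform_label hl S (δ := δ * ε)
    (mul_pos (NNReal.coe_pos.2 hδ) hε)
  have hε0 : ENNReal.ofReal ε ≠ 0 := (ENNReal.ofReal_pos.2 hε).ne'
  -- The components for which the labelling `q` fails are few, by Markov's inequality.
  have hmarkov : η {z | ENNReal.ofReal ε ≤ ∫⁻ y, G y ∂κ z} ≤ δ := by
    refine (meas_ge_le_lintegral_div (Measurable.lintegral_kernel hG).aemeasurable hε0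
      ENNReal.ofReal_ne_top).trans ?_
    rw [← Measure.lintegral_bind κ.measurable.aemeasurable hG.aemeasurable, hκ.bind_eq]
    refine ENNReal.div_le_of_le_mul (hGν.trans ?_)
    rw [ENNReal.ofReal_mul (NNReal.coe_nonneg δ), ENNReal.ofReal_coe_nnreal]
  rw [zero_add]
  refine le_trans ?_ hmarkov
  refine measure_mono_ae ?_
  filter_upwards [hκ.ergodic] with z hz hbad
  by_contra hlt
  refine hbad ⟨q, hq, fun g hg i j => ?_⟩
  have h1 := (hGρ (κ z) g hg i j).trans_lt (not_le.1 hlt)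
  exact (ENNReal.ofReal_lt_ofReal_iff hε).1 h1

end ErgodicSide

/-! ### Countably many tests suffice -/

section Dense

/-- The labellings read off from finitely many members of a countable generating algebra of sets
are dense among all labellings, with respect to every finite measure. -/
theorem exists_countable_dense_labels (X ι : Type*) [MeasurableSpace X]
    [MeasurableSpace.CountablyGenerated X] [Fintype ι] [Nonempty ι] [MeasurableSpace ι]
    [MeasurableSingletonClass ι] :
    ∃ L : Set (X → ι), L.Countable ∧ (∀ l ∈ L, Measurable l) ∧
      ∀ (ρ : Measure X) [IsFiniteMeasure ρ] (l : X → ι), Measurable l → ∀ δ : ℝ, 0 < δ →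
        ∃ l' ∈ L, ρ.real {x | l x ≠ l' x} < δ := by
  classical
  obtain ⟨b, hbc, hb⟩ := MeasurableSpace.CountablyGenerated.isCountablyGenerated (α := X)
  let A : Set (Set X) := generateSetAlgebra b
  have hAc : A.Countable := countable_generateSetAlgebra hbc
  have hAgen : ‹MeasurableSpace X› = MeasurableSpace.generateFrom A := by
    rw [hb]
    exact (generateFrom_generateSetAlgebra_eq).symm
  have hdense (ρ : Measure X) [IsFiniteMeasure ρ] : ρ.MeasureDense A :=
    Measure.MeasureDense.of_generateFrom_isSetAlgebra_finite ρ isSetAlgebra_generateSetAlgebra hAgen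
  have hAm (a : A) : MeasurableSet (a : Set X) := by
    have h1 := MeasurableSpace.measurableSet_generateFrom a.2
    rw [← hAgen] at h1
    exact h1
  -- A point receives some index `i` with `x ∈ B i`, which may be unspecified.
  let F : (ι → A) → X → ι := fun B x => Classical.epsilon fun i => x ∈ (B i : Set X)
  have : Countable A := hAc.to_subtype
  refine ⟨Set.range F, Set.countable_range F, ?_, fun ρ _ l hl δ hδ => ?_⟩
  · rintro _ ⟨B, rfl⟩
    have h1 : Measurable fun x => fun i => x ∈ (B i : Set X) :=
      measurable_pi_lambda _ fun i => measurableSet_setOfPred.1 (hAm (B i))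
    exact (measurable_of_countable fun p : ι → Prop => Classical.epsilon p).comp h1
  · have hδ' : 0 < δ / (Fintype.card ι + 1) := by positivity
    choose B hBA hB using fun i => (hdense ρ).approx (l ⁻¹' {i}) (hl (measurableSet_singleton i))
      (measure_ne_top _ _) _ hδ'
    refine ⟨_, ⟨fun i => ⟨B i, hBA i⟩, rfl⟩, ?_⟩
    have hsub : {x | l x ≠ Classical.epsilon fun i => x ∈ B i} ⊆
        ⋃ i, symmDiff (l ⁻¹' {i}) (B i) := by
      intro x hx
      by_contra hcon
      have h2 : ∀ i, x ∈ B i ↔ l x = i := fun i => by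
        by_contra h3
        refine hcon (Set.mem_iUnion.2 ⟨i, ?_⟩)
        rw [Set.mem_symmDiff, Set.mem_preimage, Set.mem_singleton_iff]
        tauto
      exact hx ((h2 _).1 (Classical.epsilon_spec (p := fun i => x ∈ B i) ⟨l x, (h2 _).2 rfl⟩))
    calc _ ≤ ρ.real (⋃ i, symmDiff (l ⁻¹' {i}) (B i)) := measureReal_mono hsub
      _ ≤ ∑ i, ρ.real (symmDiff (l ⁻¹' {i}) (B i)) := measureReal_iUnion_fintype_le _
      _ ≤ ∑ _i : ι, δ / (Fintype.card ι + 1) := Finset.sum_le_sum fun i _ =>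
          ENNReal.toReal_le_of_le_ofReal hδ'.le (hB i).le
      _ = δ * (Fintype.card ι / (Fintype.card ι + 1)) := by
          rw [Finset.sum_const, Finset.card_univ, nsmul_eq_mul]; ring
      _ < δ := mul_lt_of_lt_one_right hδ ((div_lt_one (by positivity)).2 (by linarith))

variable {Γ : Type*} [Group Γ] {X Y : Type*}
  [MeasurableSpace X] [MulAction Γ X] [MeasurableSpace Y] [MulAction Γ Y]
  [MeasurableConstSMul Γ X]

theorem abs_pairStat_sub_le {ι : Type*} [MeasurableSpace ι] [MeasurableSingletonClass ι]
    [Finite ι] {μ : Measure X} [IsFiniteMeasure μ] [SMulInvariantMeasure Γ X μ] {l l' : X → ι}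
    (hl : Measurable l) (hl' : Measurable l') (g : Γ) (i j : ι) :
    |pairStat μ l g i j - pairStat μ l' g i j| ≤ 2 * μ.real {x | l x ≠ l' x} := by
  have hm : MeasurableSet {x | l x ≠ l' x} := (measurableSet_eq_fun hl hl').compl
  have hg : μ.real {x | l (g • x) ≠ l' (g • x)} = μ.real {x | l x ≠ l' x} :=
    (measurePreserving_smul g μ).measureReal_preimage hm.nullMeasurableSet
  calc _ ≤ μ.real ({x | l (g • x) ≠ l' (g • x)} ∪ {x | l x ≠ l' x}) := by
        refine abs_measureReal_sub_le_of_subset (measurableSet_pair hl g i j)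
          (measurableSet_pair hl' g i j) fun x hx => ?_
        by_contra hcon
        simp only [Set.mem_union, Set.mem_ofPred_eq, not_or, not_not] at hcon
        simp only [Set.mem_symmDiff, Set.mem_ofPred_eq, hcon.1, hcon.2] at hx
        tauto
    _ ≤ _ := measureReal_union_le _ _
    _ = _ := by rw [hg, two_mul]

/-- To establish weak containment for almost every member of a family of actions, or weak
containment in almost every member, it suffices to treat each test separately. -/
theorem ae_weaklyContained_of_forall_label [Countable Γ]
    [MeasurableSpace.CountablyGenerated X] {Z : Type*} [MeasurableSpace Z] {η : Measure Z}
    {μ : Z → Measure X} {ν : Z → Measure Y}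
    (hμ : ∀ᵐ z ∂η, IsProbabilityMeasure (μ z) ∧ SMulInvariantMeasure Γ X (μ z))
    (h : ∀ (n : ℕ) (l : X → Fin n), Measurable l → ∀ (S : Finset Γ) (ε : ℝ), 0 < ε →
      ∀ᵐ z ∂η, ∃ q : Y → Fin n, Measurable q ∧
        ∀ g ∈ S, ∀ i j, |pairStat (μ z) l g i j - pairStat (ν z) q g i j| < ε) :
    ∀ᵐ z ∂η, WeaklyContained Γ (μ z) (ν z) := by
  choose L hLc hLm hLd using fun n : ℕ => exists_countable_dense_labels X (Fin (n + 1))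
  have hall : ∀ᵐ z ∂η, ∀ n, ∀ l ∈ L n, ∀ (S : Finset Γ) (k : ℕ),
      ∃ q : Y → Fin (n + 1), Measurable q ∧ ∀ g ∈ S, ∀ i j,
        |pairStat (μ z) l g i j - pairStat (ν z) q g i j| < 1 / ((k : ℝ) + 1) := by
    refine ae_all_iff.2 fun n => (ae_ball_iff (hLc n)).2 fun l hl => ae_all_iff.2 fun S =>
      ae_all_iff.2 fun k => h _ l (hLm n l hl) S _ (by positivity)
  filter_upwards [hμ, hall] with z hz hzall
  obtain ⟨_, _⟩ := hz
  refine weaklyContained_iff_forall_label.2 fun n l hl S ε hε => ?_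
  cases n with
  | zero =>
    obtain ⟨x⟩ := (μ z).nonempty_of_neZero
    exact (l x).elim0
  | succ n =>
    obtain ⟨l', hl', hll'⟩ := hLd n (μ z) l hl (ε / 4) (by positivity)
    obtain ⟨k, hk⟩ := exists_nat_one_div_lt (half_pos hε)
    obtain ⟨q, hq, hqS⟩ := hzall n l' hl' S k
    refine ⟨q, hq, fun g hg i j => ?_⟩
    have h1 := abs_pairStat_sub_le (μ := μ z) hl (hLm n l' hl') g i j
    have h2 := hqS g hg i j
    have h3 := abs_sub_le (pairStat (μ z) l g i j) (pairStat (μ z) l' g i j)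
      (pairStat (ν z) q g i j)
    linarith

end Dense

/-- An ergodic action weakly contained in `ν` is weakly contained in almost every ergodic
component of `ν`. -/
theorem WeaklyContained.almostEveryErgodicComponent_right {Γ : Type u} [Group Γ] [Countable Γ]
    {X : Type v} {Y : Type w} [MeasurableSpace X] [MulAction Γ X] [MeasurableSpace Y]
    [MulAction Γ Y] [MeasurableConstSMul Γ X] [MeasurableConstSMul Γ Y]
    [MeasurableSpace.CountablyGenerated X] {μ : Measure X} [IsProbabilityMeasure μ]
    [ErgodicSMul Γ X μ] {ν : Measure Y} [IsFiniteMeasure ν] (h : WeaklyContained Γ μ ν) :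
    AlmostEveryErgodicComponent.{u, w, z} Γ ν fun e => WeaklyContained Γ μ e := by
  intro Z _ η κ hκ
  exact ae_weaklyContained_of_forall_label (μ := fun _ => μ) (ν := fun z => κ z)
    (Filter.Eventually.of_forall fun _ => ⟨inferInstance, inferInstance⟩)
    fun n l hl S ε hε => h.ae_exists_label hκ hl S hε

/-! ### Weak containment in an ergodic action -/

section Mixing

variable {Γ : Type*} [Group Γ] {X : Type*} [MeasurableSpace X] [MulAction Γ X]
  [MeasurableConstSMul Γ X]

/-- In an ergodic action, almost invariant sets are almost independent of any given set. -/
theorem exists_finset_abs_measureReal_inter_sub_le (μ : Measure X) [IsProbabilityMeasure μ]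
    [ErgodicSMul Γ X μ] {E : Set X} (hE : MeasurableSet E) {ε : ℝ} (hε : 0 < ε) :
    ∃ T : Finset Γ, ∀ D : Set X, MeasurableSet D →
      (∀ g ∈ T, μ.real (symmDiff ((g • ·) ⁻¹' D) D) ≤ ε / 2) →
        |μ.real (E ∩ D) - μ.real E * μ.real D| ≤ ε := by
  have hf : Measurable (E.indicator (1 : X → ℝ)) := measurable_one.indicator hE
  have hf01 : ∀ x, E.indicator (1 : X → ℝ) x ∈ Set.Icc (0 : ℝ) 1 := fun x => by
    by_cases hx : x ∈ E <;> simp [hx]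
  obtain ⟨T, c, hc, hc1, hlt⟩ := exists_average_sub_integral_lt (Γ := Γ) μ hf hf01 (half_pos hε)
  rw [integral_indicator_one hE] at hlt
  refine ⟨T, fun D hD hDT => ?_⟩
  have hgE (g : Γ) : MeasurableSet ((g • ·) ⁻¹' E) := measurable_const_smul g hE
  have hgD (g : Γ) : MeasurableSet ((g • ·) ⁻¹' D) := measurable_const_smul g hD
  have h1 (g : Γ) (hg : g ∈ T) : |μ.real (((g • ·) ⁻¹' E) ∩ D) - μ.real (E ∩ D)| ≤ ε / 2 := by
    have h2 : μ.real (((g • ·) ⁻¹' E) ∩ ((g • ·) ⁻¹' D)) = μ.real (E ∩ D) :=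
      (measurePreserving_smul g μ).measureReal_preimage (hE.inter hD).nullMeasurableSet
    rw [← h2, abs_sub_comm]
    refine (abs_measureReal_sub_le_of_subset ((hgE g).inter (hgD g)) ((hgE g).inter hD)
      fun x hx => ?_).trans (hDT g hg)
    simp only [Set.mem_symmDiff, Set.mem_inter_iff] at hx ⊢
    tauto
  have hi (g : Γ) : Integrable (fun x => c g * E.indicator (1 : X → ℝ) (g • x))
      (μ.restrict D) :=
    (integrable_of_mem_Icc (hf.comp (measurable_const_smul g)) fun x => hf01 (g • x)).const_mul _
  have h3 : ∫ x in D, (∑ g ∈ T, c g * E.indicator (1 : X → ℝ) (g • x) - μ.real E) ∂μ =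
      ∑ g ∈ T, c g * μ.real (((g • ·) ⁻¹' E) ∩ D) - μ.real E * μ.real D := by
    rw [integral_sub (integrable_finsetSum _ fun g _ => hi g) (integrable_const _),
      integral_finsetSum _ fun g _ => hi g, setIntegral_const, smul_eq_mul, mul_comm (μ.real D)]
    congr 1
    refine Finset.sum_congr rfl fun g _ => ?_
    have h4 : ∀ x, E.indicator (1 : X → ℝ) (g • x) =
        ((g • ·) ⁻¹' E).indicator (1 : X → ℝ) x := fun x => rfl
    simp_rw [h4]
    rw [integral_const_mul, integral_indicator_one (hgE g), measureReal_restrict_apply (hgE g)]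
  have h5 : |∑ g ∈ T, c g * μ.real (((g • ·) ⁻¹' E) ∩ D) - μ.real E * μ.real D| ≤ ε / 2 := by
    rw [← h3]
    refine abs_integral_le_integral_abs.trans ((setIntegral_le_integral ?_ ?_).trans hlt.le)
    · exact ((integrable_finsetSum _ fun g _ => (integrable_of_mem_Icc
        (hf.comp (measurable_const_smul g)) fun x => hf01 (g • x)).const_mul _).sub
          (integrable_const _)).abs
    · exact Filter.Eventually.of_forall fun x => abs_nonneg _
  have h6 : |μ.real (E ∩ D) - ∑ g ∈ T, c g * μ.real (((g • ·) ⁻¹' E) ∩ D)| ≤ ε / 2 := by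
    have h7 : μ.real (E ∩ D) - ∑ g ∈ T, c g * μ.real (((g • ·) ⁻¹' E) ∩ D) =
        ∑ g ∈ T, c g * (μ.real (E ∩ D) - μ.real (((g • ·) ⁻¹' E) ∩ D)) := by
      simp_rw [mul_sub, Finset.sum_sub_distrib, ← Finset.sum_mul, hc1, one_mul]
    rw [h7]
    calc _ ≤ ∑ g ∈ T, c g * (ε / 2) := by
          refine (Finset.abs_sum_le_sum_abs _ _).trans (Finset.sum_le_sum fun g hg => ?_)
          rw [abs_mul, abs_of_nonneg (hc g hg), abs_sub_comm]
          exact mul_le_mul_of_nonneg_left (h1 g hg) (hc g hg)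
      _ = ε / 2 := by rw [← Finset.sum_mul, hc1, one_mul]
  linarith [abs_sub_le (μ.real (E ∩ D)) (∑ g ∈ T, c g * μ.real (((g • ·) ⁻¹' E) ∩ D))
    (μ.real E * μ.real D)]

/-- Removing an almost independent set `D` of measure about `s` from a set `E` of measure
about `a` leaves a set of measure about `(1 - s) a`. -/
theorem abs_measureReal_sdiff_sub_le {μ : Measure X} [IsProbabilityMeasure μ] {E D : Set X}
    (hD : MeasurableSet D) {a s t : ℝ} (hs0 : 0 ≤ s) (hs1 : s ≤ 1) (hE : |μ.real E - a| ≤ t)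
    (hDs : |μ.real D - s| ≤ t) (hind : |μ.real (E ∩ D) - μ.real E * μ.real D| ≤ t) :
    |μ.real (E \ D) - (1 - s) * a| ≤ 4 * t := by
  have h1 : μ.real (E \ D) = μ.real E - μ.real (E ∩ D) := by
    rw [← measureReal_inter_add_sdiff (s := E) hD]; ring
  have h2 : μ.real (E \ D) - (1 - s) * a =
      (1 - s) * (μ.real E - a) - (μ.real (E ∩ D) - μ.real E * μ.real D)
        - μ.real E * (μ.real D - s) := by rw [h1]; ring
  have h3 : |(1 - s) * (μ.real E - a)| ≤ t := by
    rw [abs_mul, abs_of_nonneg (by linarith)]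
    exact (mul_le_of_le_one_left (abs_nonneg _) (by linarith)).trans hE
  have h4 : |μ.real E * (μ.real D - s)| ≤ t := by
    rw [abs_mul, abs_of_nonneg measureReal_nonneg]
    exact (mul_le_of_le_one_left (abs_nonneg _) measureReal_le_one).trans hDs
  rw [h2]
  have h5 := abs_sub ((1 - s) * (μ.real E - a) - (μ.real (E ∩ D) - μ.real E * μ.real D))
    (μ.real E * (μ.real D - s))
  have h6 := abs_sub ((1 - s) * (μ.real E - a)) (μ.real (E ∩ D) - μ.real E * μ.real D)
  linarith [abs_nonneg (μ.real E - a)]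

end Mixing

section PartialLabellings

variable {Γ : Type*} [Group Γ] {X ι : Type*} [MeasurableSpace X] [MulAction Γ X]

/-- The labelling `q`, defined on the set where `q x ≠ none`, of measure about `r`, has
statistics `r • σ` up to `ε`. -/
def IsPartialLabelling (μ : Measure X) (S : Finset Γ) (σ : Γ → ι → ι → ℝ) (r ε : ℝ)
    (q : X → Option ι) : Prop :=
  |μ.real {x | q x ≠ none} - r| ≤ ε ∧
    ∀ g ∈ S, ∀ i j, |pairStat μ q g (some i) (some j) - r * σ g i j| ≤ ε

variable [MeasurableConstSMul Γ X] [Fintype ι] [MeasurableSpace (Option ι)]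
  [MeasurableSingletonClass (Option ι)]

omit [MulAction Γ X] [MeasurableConstSMul Γ X] [Fintype ι] in
theorem measurableSet_ne_none {q : X → Option ι} (hq : Measurable q) :
    MeasurableSet {x | q x ≠ none} :=
  (hq (measurableSet_singleton none)).compl

/-- Partial labellings with almost invariant domains can be placed on top of a given partial
labelling `q`: their domains can be taken almost independent of all events defined by `q`. -/
theorem exists_isPartialLabelling_orElse {μ : Measure X} [IsProbabilityMeasure μ]
    [ErgodicSMul Γ X μ] {S : Finset Γ} {σ : Γ → ι → ι → ℝ} {s : ℝ} (hs0 : 0 ≤ s) (hs1 : s ≤ 1)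
    (hbase : ∀ (T : Finset Γ) (ε : ℝ), 0 < ε → ∃ q : X → Option ι, Measurable q ∧
      IsPartialLabelling μ S σ s ε q ∧
      ∀ g ∈ T, μ.real (symmDiff ((g • ·) ⁻¹' {x | q x ≠ none}) {x | q x ≠ none}) ≤ ε)
    {r t : ℝ} (ht : 0 < t) {q : X → Option ι} (hqm : Measurable q)
    (hq : IsPartialLabelling μ S σ r t q) :
    ∃ q' : X → Option ι, Measurable q' ∧
      IsPartialLabelling μ S σ (s + (1 - s) * r) (6 * t) q' := by
  classical
  have hEm (g : Γ) (i j : ι) : MeasurableSet {x | q (g • x) = some i ∧ q x = some j} :=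
    measurableSet_pair hqm g (some i) (some j)
  choose T hT using fun p : Γ × ι × ι =>
    exists_finset_abs_measureReal_inter_sub_le (Γ := Γ) μ (hEm p.1 p.2.1 p.2.2) ht
  obtain ⟨T₀, hT₀⟩ :=
    exists_finset_abs_measureReal_inter_sub_le (Γ := Γ) μ (measurableSet_ne_none hqm) ht
  obtain ⟨k, hkm, ⟨hk0, hkS⟩, hkT⟩ := hbase
    (T₀ ∪ S ∪ (S ×ˢ (Finset.univ : Finset (ι × ι))).biUnion T) (t / 2) (half_pos ht)
  set D : Set X := {x | k x ≠ none} with hD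
  have hDm : MeasurableSet D := measurableSet_ne_none hkm
  have hDs : |μ.real D - s| ≤ t := by linarith
  have hq'm : Measurable fun x => (k x).or (q x) := by
    have h1 := (measurable_of_countable fun p : Option ι × Option ι => p.1.or p.2).comp
      (hkm.prodMk hqm)
    exact h1
  refine ⟨fun x => (k x).or (q x), hq'm, ?_, fun g hg i j => ?_⟩
  · have h1 : {x | (k x).or (q x) ≠ none} = D ∪ ({x | q x ≠ none} \ D) := by
      ext x
      simp only [hD, Set.mem_ofPred_eq, Set.mem_union, Set.mem_sdiff, ne_eq, Option.or_eq_none_iff]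
      tauto
    rw [h1, measureReal_union Set.disjoint_sdiff_right ((measurableSet_ne_none hqm).diff hDm)]
    have h2 := abs_measureReal_sdiff_sub_le hDm hs0 hs1 hq.1 hDs (hT₀ D hDm fun g hg =>
      hkT g (Finset.mem_union_left _ (Finset.mem_union_left _ hg)))
    have h3 := abs_add_le (μ.real D - s) (μ.real ({x | q x ≠ none} \ D) - (1 - s) * r)
    rw [show μ.real D + μ.real ({x | q x ≠ none} \ D) - (s + (1 - s) * r) = (μ.real D - s) +
      (μ.real ({x | q x ≠ none} \ D) - (1 - s) * r) by ring]
    linarith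
  · set E : Set X := {x | q (g • x) = some i ∧ q x = some j} with hE
    set F : Set X := {x | k (g • x) = some i ∧ k x = some j} with hF
    have hFm : MeasurableSet F := measurableSet_pair hkm g (some i) (some j)
    have h2 := abs_measureReal_sdiff_sub_le hDm hs0 hs1 (hq.2 g hg i j) hDs
      (hT (g, i, j) D hDm fun g' hg' => hkT g' (Finset.mem_union_right _
        (Finset.mem_biUnion.2 ⟨(g, i, j), Finset.mem_product.2 ⟨hg, Finset.mem_univ _⟩, hg'⟩)))
    -- Pairs of labels of different origin occur only where `x` and `g • x` are separated by `D`.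
    have h3 : |pairStat μ (fun x => (k x).or (q x)) g (some i) (some j) - μ.real (F ∪ E \ D)| ≤
        t / 2 := by
      refine (abs_measureReal_sub_le_of_subset (measurableSet_pair hq'm g (some i) (some j))
        (hFm.union ((hEm g i j).diff hDm)) fun x hx => ?_).trans
          (hkT g (Finset.mem_union_left _ (Finset.mem_union_right _ hg)))
      by_contra hcon
      simp only [Set.mem_symmDiff, hD, hF, Set.mem_ofPred_eq, Set.mem_union, Set.mem_sdiff,
        Set.mem_preimage, ne_eq] at hx hcon
      rcases h4 : k x with _ | a <;> rcases h5 : k (g • x) with _ | b <;>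
        simp [h4, h5] at hx hcon <;> tauto
    have hdisj : Disjoint F (E \ D) := by
      refine Set.disjoint_left.2 fun x hx hx' => hx'.2 ?_
      simp [hD, hx.2]
    rw [measureReal_union hdisj ((hEm g i j).diff hDm)] at h3
    have h4 : |μ.real F - s * σ g i j| ≤ t / 2 := hkS g hg i j
    have h5 := abs_add_le (μ.real F - s * σ g i j) (μ.real (E \ D) - (1 - s) * (r * σ g i j))
    have h6 := abs_sub_le (pairStat μ (fun x => (k x).or (q x)) g (some i) (some j))
      (μ.real F + μ.real (E \ D)) ((s + (1 - s) * r) * σ g i j)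
    rw [show μ.real F + μ.real (E \ D) - (s + (1 - s) * r) * σ g i j = (μ.real F - s * σ g i j) +
      (μ.real (E \ D) - (1 - s) * (r * σ g i j)) by ring] at h6
    change |μ.real (E \ D) - _| ≤ _ at h2
    linarith

/-- Iterating the superposition of partial labellings exhausts the space. -/
theorem exists_isPartialLabelling_pow {μ : Measure X} [IsProbabilityMeasure μ]
    [ErgodicSMul Γ X μ] {S : Finset Γ} {σ : Γ → ι → ι → ℝ} {s : ℝ} (hs0 : 0 ≤ s) (hs1 : s ≤ 1)
    (hbase : ∀ (T : Finset Γ) (ε : ℝ), 0 < ε → ∃ q : X → Option ι, Measurable q ∧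
      IsPartialLabelling μ S σ s ε q ∧
      ∀ g ∈ T, μ.real (symmDiff ((g • ·) ⁻¹' {x | q x ≠ none}) {x | q x ≠ none}) ≤ ε)
    (m : ℕ) {ε : ℝ} (hε : 0 < ε) :
    ∃ q : X → Option ι, Measurable q ∧ IsPartialLabelling μ S σ (1 - (1 - s) ^ m) ε q := by
  induction m generalizing ε with
  | zero =>
    refine ⟨fun _ => none, measurable_const, ?_, fun g _ i j => ?_⟩
    · simpa using hε.le
    · simpa [pairStat] using hε.le
  | succ m ih =>
    obtain ⟨q, hqm, hq⟩ := ih (ε := ε / 6) (by positivity)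
    obtain ⟨q', hq'm, hq'⟩ :=
      exists_isPartialLabelling_orElse hs0 hs1 hbase (by positivity) hqm hq
    refine ⟨q', hq'm, ?_⟩
    convert hq' using 1 <;> ring

/-- A partial labelling whose domain has almost full measure extends to a labelling with almost
the same statistics. -/
theorem IsPartialLabelling.exists_label {μ : Measure X} [IsProbabilityMeasure μ]
    [SMulInvariantMeasure Γ X μ] [MeasurableSpace ι] [MeasurableSingletonClass ι] [Nonempty ι]
    {S : Finset Γ} {σ : Γ → ι → ι → ℝ} (hσ : ∀ g i j, σ g i j ∈ Set.Icc (0 : ℝ) 1) {r ε : ℝ}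
    (hr : r ≤ 1) {q : X → Option ι} (hqm : Measurable q) (hq : IsPartialLabelling μ S σ r ε q) :
    ∃ k : X → ι, Measurable k ∧
      ∀ g ∈ S, ∀ i j, |pairStat μ k g i j - σ g i j| ≤ 3 * ε + 3 * (1 - r) := by
  have hkm : Measurable fun x => (q x).getD (Classical.arbitrary ι) :=
    (measurable_of_countable fun o : Option ι => o.getD (Classical.arbitrary ι)).comp hqm
  refine ⟨_, hkm, fun g hg i j => ?_⟩
  have hnone : μ.real {x | q x = none} ≤ 1 - r + ε := by
    have h1 := measureReal_compl (μ := μ) (measurableSet_ne_none hqm)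
    have h2 : {x | q x ≠ none}ᶜ = {x | q x = none} := by ext x; simp
    rw [h2, probReal_univ] at h1
    linarith [(abs_le.1 hq.1).1]
  have hgnone : μ.real {x | q (g • x) = none} = μ.real {x | q x = none} :=
    (measurePreserving_smul g μ).measureReal_preimage
      (hqm (measurableSet_singleton none)).nullMeasurableSet
  have h3 : |pairStat μ (fun x => (q x).getD (Classical.arbitrary ι)) g i j -
      pairStat μ q g (some i) (some j)| ≤ 2 * (1 - r + ε) := by
    refine (abs_measureReal_sub_le_of_subset (C := {x | q (g • x) = none} ∪ {x | q x = none})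
      (measurableSet_pair hkm g i j) (measurableSet_pair hqm g (some i) (some j))
      fun x hx => ?_).trans ((measureReal_union_le _ _).trans (by linarith))
    by_contra hcon
    simp only [Set.mem_union, Set.mem_ofPred_eq, not_or] at hcon
    obtain ⟨a, ha⟩ := Option.ne_none_iff_exists'.1 hcon.1
    obtain ⟨b, hb⟩ := Option.ne_none_iff_exists'.1 hcon.2
    simp only [Set.mem_symmDiff, Set.mem_ofPred_eq, ha, hb, Option.getD_some,
      Option.some.injEq] at hx
    tauto
  have h4 := hq.2 g hg i j
  have h5 : |r * σ g i j - σ g i j| ≤ 1 - r := by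
    rw [show r * σ g i j - σ g i j = -((1 - r) * σ g i j) by ring, abs_neg,
      abs_of_nonneg (mul_nonneg (by linarith) (hσ g i j).1)]
    exact mul_le_of_le_one_right (by linarith) (hσ g i j).2
  linarith [abs_sub_le (pairStat μ (fun x => (q x).getD (Classical.arbitrary ι)) g i j)
    (pairStat μ q g (some i) (some j)) (r * σ g i j),
    abs_sub_le (pairStat μ (fun x => (q x).getD (Classical.arbitrary ι)) g i j)
      (r * σ g i j) (σ g i j)]

end PartialLabellings

section InvariantSubset

variable {Γ : Type*} [Group Γ] {X W : Type*}
  [MeasurableSpace X] [MulAction Γ X] [MeasurableSpace W] [MulAction Γ W]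
  [MeasurableConstSMul Γ X] [MeasurableConstSMul Γ W]

/-- If `ν` is weakly contained in an ergodic action, then so is the normalized restriction `ρ`
of `ν` to an invariant set of positive measure. The normalization is expressed by `hρ`, so that
`ρ` may be given in another form than as a conditional measure. -/
theorem WeaklyContained.of_invariant_set {ν : Measure W} [IsProbabilityMeasure ν]
    {μ : Measure X} [IsProbabilityMeasure μ] [ErgodicSMul Γ X μ] (h : WeaklyContained Γ ν μ)
    {A : Set W} (hA : MeasurableSet A) (hAinv : ∀ g : Γ, (g • ·) ⁻¹' A =ᵐ[ν] A) {ρ : Measure W}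
    [IsProbabilityMeasure ρ] {s : ℝ} (hs : 0 < s)
    (hρ : ∀ E : Set W, MeasurableSet E → ν.real (E ∩ A) = s * ρ.real E) :
    WeaklyContained Γ ρ μ := by
  classical
  refine weaklyContained_iff_forall_label.2 fun n l hl S ε hε => ?_
  have hνA : ν.real A = s := by simpa using hρ Set.univ MeasurableSet.univ
  have hs1 : s ≤ 1 := hνA ▸ measureReal_le_one
  have : Nonempty (Fin n) := ρ.nonempty_of_neZero.map l
  let _ : MeasurableSpace (Option (Fin n)) := ⊤
  -- The labelling `l` on `A`, with the additional label `none` outside of `A`.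
  let l' : W → Option (Fin n) := fun y => if y ∈ A then some (l y) else none
  have hl' : Measurable l' :=
    Measurable.ite hA ((measurable_of_countable some).comp hl) measurable_const
  have hsome (y : W) (i : Fin n) : l' y = some i ↔ y ∈ A ∧ l y = i := by
    simp only [l']; split_ifs with hy <;> simp [hy]
  have hne (y : W) : l' y ≠ none ↔ y ∈ A := by
    simp only [l']; split_ifs with hy <;> simp [hy]
  have hstat (g : Γ) (i j : Fin n) :
      pairStat ν l' g (some i) (some j) = s * pairStat ρ l g i j := by
    rw [pairStat, pairStat, ← hρ _ (measurableSet_pair hl g i j)]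
    refine measureReal_congr ?_
    filter_upwards [hAinv g] with y hy
    have hy' : (g • y ∈ A) = (y ∈ A) := hy
    refine propext ?_
    change (l' (g • y) = some i ∧ l' y = some j) ↔ ((l (g • y) = i ∧ l y = j) ∧ y ∈ A)
    rw [hsome, hsome, hy']
    tauto
  have hbase : ∀ (T : Finset Γ) (ε : ℝ), 0 < ε → ∃ q : X → Option (Fin n), Measurable q ∧
      IsPartialLabelling μ S (pairStat ρ l) s ε q ∧
      ∀ g ∈ T, μ.real (symmDiff ((g • ·) ⁻¹' {x | q x ≠ none}) {x | q x ≠ none}) ≤ ε := by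
    intro T ε hε
    set N : ℕ := Fintype.card (Option (Fin n) × Option (Fin n)) with hN
    have hN0 : (0 : ℝ) ≤ N := Nat.cast_nonneg _
    have hNε : (N : ℝ) * (ε / (N + 1)) ≤ ε := by
      rw [mul_div_assoc', div_le_iff₀ (by positivity)]
      nlinarith
    obtain ⟨q, hqm, hq⟩ := h.exists_label hl' (insert 1 (S ∪ T)) (ε := ε / (N + 1)) (by positivity)
    have hrel (g : Γ) (hg : g ∈ insert 1 (S ∪ T)) (R : Option (Fin n) → Option (Fin n) → Prop) :=
      (abs_measureReal_rel_sub_le hl' hqm (hq g hg) R).trans hNε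
    refine ⟨q, hqm, ⟨?_, fun g hg i j => ?_⟩, fun g hg => ?_⟩
    · have h1 := hrel 1 (Finset.mem_insert_self _ _) fun _ b => b ≠ none
      simp_rw [hne] at h1
      rw [abs_sub_comm, ← hνA]
      exact h1
    · have h1 := hq g (Finset.mem_insert_of_mem (Finset.mem_union_left _ hg)) (some i) (some j)
      rw [hstat, abs_sub_comm] at h1
      exact h1.le.trans (div_le_self hε.le (by linarith))
    · have h1 := hrel g (Finset.mem_insert_of_mem (Finset.mem_union_right _ hg))
        fun a b => (a ≠ none ∧ ¬ b ≠ none) ∨ (b ≠ none ∧ ¬ a ≠ none)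
      have h2 : ν.real {y | (l' (g • y) ≠ none ∧ ¬ l' y ≠ none) ∨
          (l' y ≠ none ∧ ¬ l' (g • y) ≠ none)} = 0 := by
        simp_rw [hne]
        have h3 : ν (symmDiff ((g • ·) ⁻¹' A) A) = 0 := measure_symmDiff_eq_zero_iff.2 (hAinv g)
        have h4 : ν.real (symmDiff ((g • ·) ⁻¹' A) A) = 0 := by simp [Measure.real, h3]
        exact h4
      rw [h2, zero_sub, abs_neg, abs_of_nonneg measureReal_nonneg] at h1
      exact h1
  obtain ⟨m, hm⟩ := exists_pow_lt_of_lt_one (show 0 < ε / 8 by positivity)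
    (show 1 - s < 1 by linarith)
  obtain ⟨q, hqm, hq⟩ := exists_isPartialLabelling_pow hs.le hs1 hbase m
    (show 0 < ε / 8 by positivity)
  have hpow : 0 ≤ (1 - s) ^ m := pow_nonneg (by linarith) m
  obtain ⟨k, hkm, hk⟩ := hq.exists_label
    (fun g i j => ⟨measureReal_nonneg, measureReal_le_one⟩) (by linarith) hqm
  refine ⟨k, hkm, fun g hg i j => ?_⟩
  rw [abs_sub_comm]
  have h1 : |pairStat μ k g i j - pairStat ρ l g i j| ≤ _ := hk g hg i j
  linarith

end InvariantSubset

/-! ### Ergodic components of an action weakly contained in an ergodic one -/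

section Components

variable {Γ : Type*} [Group Γ] {X Y : Type*}
  [MeasurableSpace X] [MulAction Γ X] [MeasurableSpace Y] [MulAction Γ Y]
  [MeasurableConstSMul Γ X] [MeasurableConstSMul Γ Y]

theorem smulInvariantMeasure_restrict {ν : Measure Y} [SMulInvariantMeasure Γ Y ν] {A : Set Y}
    (hA : MeasurableSet A) (hAinv : ∀ g : Γ, (g • ·) ⁻¹' A =ᵐ[ν] A) :
    SMulInvariantMeasure Γ Y (ν.restrict A) where
  measure_preimage_smul g E hE := by
    rw [Measure.restrict_apply hE, Measure.restrict_apply (measurable_const_smul g hE),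
      measure_congr (Filter.EventuallyEq.rfl.inter (hAinv g)).symm, ← Set.preimage_inter]
    exact SMulInvariantMeasure.measure_preimage_smul g (hE.inter hA)

/-- If averages of `f` converge to `h` in mean, then `f` and `h` have the same
integral over invariant sets. -/
theorem setIntegral_eq_of_average {ν : Measure Y} [IsProbabilityMeasure ν]
    [SMulInvariantMeasure Γ Y ν] {f h : Y → ℝ} (hf : Measurable f)
    (hf01 : ∀ y, f y ∈ Set.Icc (0 : ℝ) 1) (hh : Measurable h)
    (hh01 : ∀ y, h y ∈ Set.Icc (0 : ℝ) 1)
    (happ : ∀ ε : ℝ, 0 < ε → ∃ (T : Finset Γ) (c : Γ → ℝ), (∀ g ∈ T, 0 ≤ c g) ∧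
      ∑ g ∈ T, c g = 1 ∧ ∫ y, |∑ g ∈ T, c g * f (g • y) - h y| ∂ν < ε) {A : Set Y}
    (hA : MeasurableSet A) (hAinv : ∀ g : Γ, (g • ·) ⁻¹' A =ᵐ[ν] A) :
    ∫ y in A, f y ∂ν = ∫ y in A, h y ∂ν := by
  have := smulInvariantMeasure_restrict hA hAinv
  rw [← sub_eq_zero, ← abs_nonpos_iff]
  refine le_of_forall_pos_le_add fun δ hδ => ?_
  obtain ⟨T, c, hc, hc1, hlt⟩ := happ δ hδ
  have h1 := abs_integral_sub_integral_le_average (ν.restrict A) hf hf01 hh hh01 hc1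
  have hm := measurable_average hf T c
  have h2 : Integrable (fun y => |∑ g ∈ T, c g * f (g • y) - h y|) ν :=
    ((integrable_of_mem_Icc hm fun y => sum_mul_mem_Icc hc hc1 fun g => hf01 (g • y)).sub
      (integrable_of_mem_Icc hh hh01)).abs
  have h3 := setIntegral_le_integral (s := A) h2 (Filter.Eventually.of_forall fun y => abs_nonneg _)
  linarith

/-- If averages of `f` converge to `h` in mean, then `f` and `h` have the same integral with
respect to almost every ergodic component. -/
theorem ae_integral_eq_of_average {ν : Measure Y} [IsProbabilityMeasure ν] {Z : Type*}
    [MeasurableSpace Z] {η : Measure Z} {κ : Kernel Z Y} (hκ : IsErgodicDecomposition Γ ν η κ)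
    {f h : Y → ℝ} (hf : Measurable f)
    (hf01 : ∀ y, f y ∈ Set.Icc (0 : ℝ) 1) (hh : Measurable h)
    (hh01 : ∀ y, h y ∈ Set.Icc (0 : ℝ) 1)
    (happ : ∀ ε : ℝ, 0 < ε → ∃ (T : Finset Γ) (c : Γ → ℝ), (∀ g ∈ T, 0 ≤ c g) ∧
      ∑ g ∈ T, c g = 1 ∧ ∫ y, |∑ g ∈ T, c g * f (g • y) - h y| ∂ν < ε) :
    ∀ᵐ z ∂η, ∫ y, f y ∂κ z = ∫ y, h y ∂κ z := by
  have := hκ.isMarkovKernel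
  have hm : Measurable fun z => ENNReal.ofReal |∫ y, f y ∂κ z - ∫ y, h y ∂κ z| :=
    (hf.stronglyMeasurable.integral_kernel.measurable.sub
      hh.stronglyMeasurable.integral_kernel.measurable).abs.ennreal_ofReal
  have hzero : ∫⁻ z, ENNReal.ofReal |∫ y, f y ∂κ z - ∫ y, h y ∂κ z| ∂η = 0 := by
    rw [← nonpos_iff_eq_zero]
    refine ENNReal.le_of_forall_pos_le_add fun δ hδ _ => ?_
    obtain ⟨T, c, hc, hc1, hlt⟩ := happ δ (NNReal.coe_pos.2 hδ)
    have hGm : Measurable fun y => |∑ g ∈ T, c g * f (g • y) - h y| :=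
      ((measurable_average hf T c).sub hh).abs
    have hGi (ρ : Measure Y) [IsFiniteMeasure ρ] :
        Integrable (fun y => |∑ g ∈ T, c g * f (g • y) - h y|) ρ :=
      ((integrable_of_mem_Icc (measurable_average hf T c) fun y =>
        sum_mul_mem_Icc hc hc1 fun g => hf01 (g • y)).sub (integrable_of_mem_Icc hh hh01)).abs
    calc _ ≤ ∫⁻ z, ∫⁻ y, ENNReal.ofReal |∑ g ∈ T, c g * f (g • y) - h y| ∂κ z ∂η := by
          refine lintegral_mono_ae ?_
          filter_upwards [hκ.ergodic] with z hz
          rw [← ofReal_integral_eq_lintegral_ofReal (hGi (κ z))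
            (Filter.Eventually.of_forall fun y => abs_nonneg _)]
          exact ENNReal.ofReal_le_ofReal
            (abs_integral_sub_integral_le_average (κ z) hf hf01 hh hh01 hc1)
      _ = ENNReal.ofReal (∫ y, |∑ g ∈ T, c g * f (g • y) - h y| ∂ν) := by
          rw [← Measure.lintegral_bind κ.measurable.aemeasurable hGm.ennreal_ofReal.aemeasurable,
            hκ.bind_eq, ofReal_integral_eq_lintegral_ofReal (hGi ν)
            (Filter.Eventually.of_forall fun y => abs_nonneg _)]
      _ ≤ 0 + δ := by
          rw [zero_add]
          exact (ENNReal.ofReal_le_ofReal hlt.le).trans (ENNReal.ofReal_coe_nnreal).le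
  filter_upwards [(lintegral_eq_zero_iff hm).1 hzero] with z hz
  exact sub_eq_zero.1 (abs_nonpos_iff.1 (ENNReal.ofReal_eq_zero.1 hz))

/-- If `ν` is weakly contained in an ergodic action, then a single test of weak containment
passes for almost every ergodic component. The limits of the averages of the relevant indicators
are almost surely constant on a component, equal to its statistics `a`, and `a` lies in the support
of their joint distribution under `ν`. Thus `a` is almost attained by the restriction
of `ν` to an invariant set of positive measure. -/
theorem WeaklyContained.ae_exists_label_of_component [Countable Γ] {ι : Type*} [Fintype ι]
    [MeasurableSpace ι] [MeasurableSingletonClass ι] {ν : Measure Y} [IsProbabilityMeasure ν]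
    [SMulInvariantMeasure Γ Y ν] {μ : Measure X} [IsProbabilityMeasure μ] [ErgodicSMul Γ X μ]
    (h : WeaklyContained Γ ν μ) {Z : Type*} [MeasurableSpace Z] {η : Measure Z} {κ : Kernel Z Y}
    (hκ : IsErgodicDecomposition Γ ν η κ) {l : Y → ι} (hl : Measurable l) (S : Finset Γ) {ε : ℝ}
    (hε : 0 < ε) : ∀ᵐ z ∂η, ∃ q : X → ι, Measurable q ∧
      ∀ g ∈ S, ∀ i j, |pairStat (κ z) l g i j - pairStat μ q g i j| < ε := by
  have := hκ.isMarkovKernel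
  let f : S × ι × ι → Y → ℝ := fun p y =>
    pairIndicator (p.1 : Γ) p.2.1 p.2.2 fun k => l (k • y)
  have hf (p) : Measurable (f p) := measurable_pairIndicator hl _ _ _
  have hf01 (p y) : f p y ∈ Set.Icc (0 : ℝ) 1 := pairIndicator_mem_Icc _ _ _ _
  choose H hH hH01 hHinv hHapp using fun p => exists_invariant_average (Γ := Γ) ν (hf p) (hf01 p)
  let F : Y → S × ι × ι → ℝ := fun y p => H p y
  have hF : Measurable F := measurable_pi_lambda _ hH
  have hFinv : ∀ᵐ y ∂ν, ∀ (g : Γ) (p), H p (g • y) = H p y :=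
    ae_all_iff.2 fun g => ae_all_iff.2 fun p => hHinv p g
  have hsupp : ∀ᵐ y ∂ν, F y ∈ (ν.map F).support :=
    ae_of_ae_map hF.aemeasurable Measure.support_mem_ae
  rw [← hκ.bind_eq] at hFinv hsupp
  filter_upwards [hκ.ergodic, Measure.ae_ae_of_ae_bind κ.measurable.aemeasurable hFinv,
    Measure.ae_ae_of_ae_bind κ.measurable.aemeasurable hsupp,
    ae_all_iff.2 fun p => ae_integral_eq_of_average hκ (hf p) (hf01 p) (hH p) (hH01 p) (hHapp p)]
    with z hz hzinv hzsupp hzint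
  have hconst (p) : H p =ᵐ[κ z] fun _ => pairStat (κ z) l (p.1 : Γ) p.2.1 p.2.2 := by
    obtain ⟨a, ha⟩ := exists_ae_eq_const_of_ergodicSMul (Γ := Γ) (κ z) (hH p) fun g =>
      hzinv.mono fun y hy => hy g p
    have h1 : pairStat (κ z) l (p.1 : Γ) p.2.1 p.2.2 = a := by
      rw [← integral_pairIndicator (κ z) hl, hzint p, integral_congr_ae ha, integral_const,
        probReal_univ, one_smul]
    rwa [h1]
  let a : S × ι × ι → ℝ := fun p => pairStat (κ z) l (p.1 : Γ) p.2.1 p.2.2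
  obtain ⟨y, hy, hysupp⟩ := ((ae_all_iff.2 hconst).and hzsupp).exists
  have hya : F y = a := funext hy
  rw [hya, hκ.bind_eq, Measure.mem_support_iff_forall] at hysupp
  let A : Set Y := F ⁻¹' Metric.ball a (ε / 2)
  have hA : MeasurableSet A := hF Metric.isOpen_ball.measurableSet
  have hA0 : 0 < ν A := by
    have h1 := hysupp _ (Metric.ball_mem_nhds a (half_pos hε))
    rwa [Measure.map_apply hF Metric.isOpen_ball.measurableSet] at h1
  have hAinv (g : Γ) : (g • ·) ⁻¹' A =ᵐ[ν] A := by
    rw [hκ.bind_eq] at hFinv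
    filter_upwards [hFinv] with y hy
    have h1 : F (g • y) = F y := funext fun p => hy g p
    exact congrArg (· ∈ Metric.ball a (ε / 2)) h1
  have hρprob : IsProbabilityMeasure ν[|A] := cond_isProbabilityMeasure hA0.ne'
  have hs : 0 < ν.real A := ENNReal.toReal_pos hA0.ne' (measure_ne_top _ _)
  have hρ (E : Set Y) : ν.real (E ∩ A) = ν.real A * (ν[|A]).real E := by
    rw [measureReal_def (ν[|A]), cond_apply hA, ENNReal.toReal_mul, ENNReal.toReal_inv,
      ← measureReal_def, ← measureReal_def, mul_inv_cancel_left₀ hs.ne', Set.inter_comm]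
  obtain ⟨q, hq, hqS⟩ := (h.of_invariant_set hA hAinv hs fun E _ => hρ E).exists_label hl S
    (half_pos hε)
  refine ⟨q, hq, fun g hg i j => ?_⟩
  let p : S × ι × ι := (⟨g, hg⟩, i, j)
  have h1 : |ν.real A * (pairStat (ν[|A]) l g i j - a p)| ≤ ε / 2 * ν.real A := by
    have h2 : ν.real A * pairStat (ν[|A]) l g i j = ∫ y in A, H p y ∂ν := by
      rw [← setIntegral_eq_of_average (hf p) (hf01 p) (hH p) (hH01 p) (hHapp p) hA hAinv, pairStat,
        ← hρ, integral_pairIndicator _ hl, pairStat,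
        measureReal_restrict_apply (measurableSet_pair hl g i j)]
    have h3 : ν.real A * (pairStat (ν[|A]) l g i j - a p) = ∫ y in A, (H p y - a p) ∂ν := by
      rw [integral_sub (integrable_of_mem_Icc (hH p) (hH01 p)) (integrable_const _), ← h2,
        setIntegral_const, smul_eq_mul, mul_sub]
    rw [h3, ← Real.norm_eq_abs]
    refine norm_setIntegral_le_of_norm_le_const (measure_lt_top _ _) fun y hy => ?_
    have h4 : dist (F y p) (a p) ≤ dist (F y) a := dist_le_pi_dist _ _ p
    exact h4.trans (Metric.mem_ball.1 hy).le
  rw [abs_mul, abs_of_pos hs, mul_comm (ε / 2), mul_le_mul_iff_of_pos_left hs, abs_sub_comm] at h1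
  have h2 : |pairStat (κ z) l g i j - pairStat (ν[|A]) l g i j| ≤ ε / 2 := h1
  linarith [hqS g hg i j, abs_sub_le (pairStat (κ z) l g i j) (pairStat (ν[|A]) l g i j)
    (pairStat μ q g i j)]

end Components

/-- Almost every ergodic component of an action weakly contained in an ergodic action is weakly
contained in it. -/
theorem WeaklyContained.almostEveryErgodicComponent_left {Γ : Type u} [Group Γ] [Countable Γ]
    {X : Type v} {Y : Type w} [MeasurableSpace X] [MulAction Γ X] [MeasurableSpace Y]
    [MulAction Γ Y] [MeasurableConstSMul Γ X] [MeasurableConstSMul Γ Y]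
    [MeasurableSpace.CountablyGenerated Y] {ν : Measure Y} [IsProbabilityMeasure ν]
    [SMulInvariantMeasure Γ Y ν] {μ : Measure X} [IsProbabilityMeasure μ] [ErgodicSMul Γ X μ]
    (h : WeaklyContained Γ ν μ) :
    AlmostEveryErgodicComponent.{u, w, z} Γ ν fun e => WeaklyContained Γ e μ := by
  intro Z _ η κ hκ
  have := hκ.isMarkovKernel
  exact ae_weaklyContained_of_forall_label (μ := fun z => κ z) (ν := fun _ => μ)
    (hκ.ergodic.mono fun z hz => ⟨inferInstance, inferInstance⟩)
    fun n l hl S ε hε => h.ae_exists_label_of_component hκ hl S hε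

/-! ### Summands of a convex sum -/

section Sum

variable {Γ : Type*} [Group Γ] {X Y Y' : Type*}
  [MeasurableSpace X] [MulAction Γ X] [MeasurableSpace Y] [MulAction Γ Y]
  [MeasurableSpace Y'] [MulAction Γ Y'] [MeasurableConstSMul Γ Y] [MeasurableConstSMul Γ Y']

instance Sum.instMeasurableConstSMul : MeasurableConstSMul Γ (Y ⊕ Y') where
  measurable_const_smul g := measurable_fun_sum
    (measurable_inl.comp (measurable_const_smul g)) (measurable_inr.comp (measurable_const_smul g))

omit [MeasurableConstSMul Γ Y'] in
instance smulInvariantMeasure_map_inl (ν : Measure Y) [SMulInvariantMeasure Γ Y ν] :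
    SMulInvariantMeasure Γ (Y ⊕ Y') (ν.map Sum.inl) where
  measure_preimage_smul g E hE := by
    rw [Measure.map_apply measurable_inl hE,
      Measure.map_apply measurable_inl (measurable_const_smul g hE)]
    exact SMulInvariantMeasure.measure_preimage_smul (μ := ν) g (measurable_inl hE)

theorem pairStat_map_inl {ι : Type*} [MeasurableSpace ι] [MeasurableSingletonClass ι]
    (ν : Measure Y) {l : Y ⊕ Y' → ι} (hl : Measurable l) (g : Γ) (i j : ι) :
    pairStat (ν.map Sum.inl) l g i j = pairStat ν (l ∘ Sum.inl) g i j := by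
  rw [pairStat, map_measureReal_apply measurable_inl (measurableSet_pair hl g i j)]
  rfl

theorem WeaklyContained.of_map_inl_right {μ : Measure X} {ν : Measure Y}
    (h : WeaklyContained Γ μ (ν.map (Sum.inl : Y → Y ⊕ Y'))) : WeaklyContained Γ μ ν := by
  refine weaklyContained_iff_forall_label.2 fun n l hl S ε hε => ?_
  obtain ⟨q, hq, hqS⟩ := weaklyContained_iff_forall_label.1 h n l hl S ε hε
  refine ⟨q ∘ Sum.inl, hq.comp measurable_inl, fun g hg i j => ?_⟩
  rw [← pairStat_map_inl ν hq]
  exact hqS g hg i j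

theorem WeaklyContained.of_map_inl_left {μ : Measure X} {ν : Measure Y} [NeZero ν]
    (h : WeaklyContained Γ (ν.map (Sum.inl : Y → Y ⊕ Y')) μ) : WeaklyContained Γ ν μ := by
  refine weaklyContained_iff_forall_label.2 fun n l hl S ε hε => ?_
  obtain ⟨y⟩ := ν.nonempty_of_neZero
  have hl' : Measurable (Sum.elim l fun _ : Y' => l y) := hl.sumElim measurable_const
  obtain ⟨q, hq, hqS⟩ := weaklyContained_iff_forall_label.1 h n _ hl' S ε hε
  refine ⟨q, hq, fun g hg i j => ?_⟩
  have h1 := hqS g hg i j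
  rwa [pairStat_map_inl ν hl'] at h1

omit [MeasurableConstSMul Γ Y] [MeasurableConstSMul Γ Y'] [MulAction Γ Y] [MulAction Γ Y'] in
theorem convexSumMeasure_eq (s : ℝ) (ν : Measure Y) (ν' : Measure Y') :
    convexSumMeasure s ν ν' =
      ENNReal.ofReal s • ν.map Sum.inl + ENNReal.ofReal (1 - s) • ν'.map Sum.inr := by
  rw [convexSumMeasure, directSumMeasure, Measure.map_smul, Measure.map_smul]

theorem isProbabilityMeasure_convexSumMeasure {s : ℝ} (hs0 : 0 ≤ s) (hs1 : s ≤ 1)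
    (ν : Measure Y) [IsProbabilityMeasure ν] (ν' : Measure Y') [IsProbabilityMeasure ν'] :
    IsProbabilityMeasure (convexSumMeasure s ν ν') := by
  have h1 := Measure.isProbabilityMeasure_map (μ := ν) (measurable_inl (β := Y')).aemeasurable
  have h2 := Measure.isProbabilityMeasure_map (μ := ν') (measurable_inr (α := Y)).aemeasurable
  constructor
  rw [convexSumMeasure_eq, Measure.add_apply, Measure.smul_apply, Measure.smul_apply, measure_univ,
    measure_univ, smul_eq_mul, smul_eq_mul, mul_one, mul_one, ← ENNReal.ofReal_add hs0
    (by linarith)]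
  simp

theorem WeaklyContained.of_convexSumMeasure_right [MeasurableConstSMul Γ X] {μ : Measure X}
    [IsProbabilityMeasure μ] [ErgodicSMul Γ X μ] {ν : Measure Y} [IsProbabilityMeasure ν]
    [SMulInvariantMeasure Γ Y ν] {ν' : Measure Y'} [IsProbabilityMeasure ν'] {s : ℝ} (hs0 : 0 < s)
    (hs1 : s ≤ 1) (h : WeaklyContained Γ μ (convexSumMeasure s ν ν')) :
    WeaklyContained Γ μ ν := by
  have h1 := isProbabilityMeasure_convexSumMeasure hs0.le hs1 ν ν'
  have h2 := Measure.isProbabilityMeasure_map (μ := ν) (measurable_inl (β := Y')).aemeasurable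
  refine (h.of_le_smul (inv_pos.2 hs0) (ρ := ν.map Sum.inl) ?_).of_map_inl_right
  rw [convexSumMeasure_eq, smul_add, smul_smul, ← ENNReal.ofReal_mul (inv_pos.2 hs0).le,
    inv_mul_cancel₀ hs0.ne', ENNReal.ofReal_one, one_smul]
  exact Measure.le_add_right le_rfl

theorem WeaklyContained.of_convexSumMeasure_left [MeasurableConstSMul Γ X] {μ : Measure X}
    [IsProbabilityMeasure μ] [ErgodicSMul Γ X μ] {ν : Measure Y} [IsProbabilityMeasure ν]
    {ν' : Measure Y'} [IsProbabilityMeasure ν'] {s : ℝ} (hs0 : 0 < s)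
    (hs1 : s ≤ 1) (h : WeaklyContained Γ (convexSumMeasure s ν ν') μ) :
    WeaklyContained Γ ν μ := by
  have h1 := isProbabilityMeasure_convexSumMeasure hs0.le hs1 ν ν'
  have h2 := Measure.isProbabilityMeasure_map (μ := ν) (measurable_inl (β := Y')).aemeasurable
  refine (h.of_invariant_set (A := Set.range Sum.inl) measurableSet_range_inl (fun g => ?_)
    (ρ := ν.map Sum.inl) hs0 fun E hE => ?_).of_map_inl_left
  · refine Filter.EventuallyEq.of_eq (Set.ext fun x => ?_)
    rcases x with y | y <;> simp
  · have hm := hE.inter (measurableSet_range_inl (α := Y) (β := Y'))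
    rw [convexSumMeasure_eq, measureReal_def, Measure.add_apply, Measure.smul_apply,
      Measure.smul_apply, Measure.map_apply measurable_inl hm, Measure.map_apply measurable_inr hm,
      map_measureReal_apply measurable_inl hE]
    have h3 : Sum.inr ⁻¹' (E ∩ Set.range (Sum.inl : Y → Y ⊕ Y')) = ∅ := by ext; simp
    have h4 : Sum.inl ⁻¹' (E ∩ Set.range (Sum.inl : Y → Y ⊕ Y')) = Sum.inl ⁻¹' E := by ext; simp
    rw [h3, h4]
    simp [measureReal_def, ENNReal.toReal_mul, ENNReal.toReal_ofReal hs0.le]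

end Sum

theorem mainTheorem5
    {Γ : Type u} [Group Γ] [Countable Γ]
    {X : Type v} [MeasurableSpace X] [StandardBorelSpace X] [MulAction Γ X]
    [MeasurableConstSMul Γ X]
    {Y : Type w} [MeasurableSpace Y] [StandardBorelSpace Y] [MulAction Γ Y]
    [MeasurableConstSMul Γ Y]
    {Y' : Type x} [MeasurableSpace Y'] [StandardBorelSpace Y'] [MulAction Γ Y']
    [MeasurableConstSMul Γ Y']
    (μ : Measure X) [IsProbabilityMeasure μ] [ErgodicSMul Γ X μ]
    (ν : Measure Y) [IsProbabilityMeasure ν] [SMulInvariantMeasure Γ Y ν]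
    (ν' : Measure Y') [IsProbabilityMeasure ν'] [SMulInvariantMeasure Γ Y' ν'] :
    (∀ s : ℝ, 0 < s → s ≤ 1 → WeaklyContained Γ μ (convexSumMeasure s ν ν') →
      WeaklyContained Γ μ ν ∧
      AlmostEveryErgodicComponent.{u, w, z} Γ ν (fun e => WeaklyContained Γ μ e)) ∧
    (∀ s : ℝ, 0 < s → s ≤ 1 → WeaklyContained Γ (convexSumMeasure s ν ν') μ →
      WeaklyContained Γ ν μ ∧
      AlmostEveryErgodicComponent.{u, w, z} Γ ν (fun e => WeaklyContained Γ e μ)) ∧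
    (∀ s : ℝ, 0 < s → s ≤ 1 → WeaklyEquivalent Γ (convexSumMeasure s ν ν') μ →
      WeaklyEquivalent Γ ν μ ∧
      AlmostEveryErgodicComponent.{u, w, z} Γ ν (fun e => WeaklyEquivalent Γ e μ)) := by

  have hright : ∀ s : ℝ, 0 < s → s ≤ 1 → WeaklyContained Γ μ (convexSumMeasure s ν ν') →
      WeaklyContained Γ μ ν ∧
      AlmostEveryErgodicComponent.{u, w, z} Γ ν (fun e => WeaklyContained Γ μ e) :=
    fun s hs0 hs1 h =>
      have hν := h.of_convexSumMeasure_right hs0 hs1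
      ⟨hν, hν.almostEveryErgodicComponent_right⟩
  have hleft : ∀ s : ℝ, 0 < s → s ≤ 1 → WeaklyContained Γ (convexSumMeasure s ν ν') μ →
      WeaklyContained Γ ν μ ∧
      AlmostEveryErgodicComponent.{u, w, z} Γ ν (fun e => WeaklyContained Γ e μ) :=
    fun s hs0 hs1 h =>
      have hν := h.of_convexSumMeasure_left hs0 hs1
      ⟨hν, hν.almostEveryErgodicComponent_left⟩
  refine ⟨hright, hleft, fun s hs0 hs1 h => ?_⟩
  obtain ⟨h1, h1'⟩ := hright s hs0 hs1 h.2
  obtain ⟨h2, h2'⟩ := hleft s hs0 hs1 h.1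
  refine ⟨⟨h2, h1⟩, fun Z _ η κ hκ => ?_⟩
  filter_upwards [h1' Z η κ hκ, h2' Z η κ hκ] with t ht1 ht2
  exact ⟨ht2, ht1⟩
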